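/- \textbf{Setting.} We work in the continuous fragment of differential dynamic logic $\mathsf{dL}$ with rich tests. Terms are polynomials with rational coefficients over a countably infinite set of variables. Formulas are generated by comparisons $p\sim q$ of terms (${\sim}\in\{=,\neq,\ge,>,\le,<\}$), $\wedge,\vee,\neg$, $\forall x$, $\exists x$ and the modalities $[x'=f(x)\,\&\,Q]\varphi$ and $\langle x'=f(x)\,\&\,Q\rangle\varphi$, where $x'=f(x)$ is a system of differential equations $x_i'=f_i(x)$ for distinct variables $x_i$ (these are the variables bound by the system; the terms $f_i$ may mention any variables) and the domain constraint $Q$ is an arbitrary formula; an omitted $Q$ means $\mathit{true}$. $\to$ and $\leftrightarrow$ are the usual abbreviations. A formula $[x'=f(x)\,\&\,Q]\varphi$ (resp. $\langle x'=f(x)\,\&\,Q\rangle\varphi$) is true in a state if $\varphi$ is true at the end of every (resp. some) solution of finite duration $\ge 0$ from that state along which $Q$ is always true. A formula is \emph{derivable} if it has a proof in the classical sequent calculus (identity, cut, structural rules, left and right rules for the connectives and quantifiers, replacement of equal variables) from all sequents that are valid in first-order real arithmetic, the rules \[\frac{\vdash\varphi}{\Gamma\vdash[\alpha]\varphi,\Delta}\qquad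 \frac{Q\vdash\varphi}{\Gamma\vdash[x'=f(x)\,\&\,Q]\varphi,\Delta}\qquad \frac{\Gamma\vdash[x'=f(x)\,\&\,Q]\chi,\Delta\qquad \Gamma\vdash[x'=f(x)\,\&\,Q\wedge\chi]\varphi,\Delta}{\Gamma\vdash[x'=f(x)\,\&\,Q]\varphi,\Delta}\] and the following axiom schemata, where $\alpha$ is any $x'=f(x)\,\&\,Q$ and $y$ is fresh: \begin{itemize} \item $\langle\alpha\rangle\varphi\leftrightarrow\neg[\alpha]\neg\varphi$;\quad $[\alpha](\varphi\to\psi)\to([\alpha]\varphi\to[\alpha]\psi)$;\quad $\varphi\to[\alpha]\varphi$ if no free variable of $\varphi$ is bound by $\alpha$; \item $\langle x'=f(x)\rangle p(x)\leftrightarrow\exists s\,(s\ge0\wedge p(Y(s)))$ for polynomial solutions $Y'(s)=f(Y(s))$, $Y(0)=x$, where $p(Y(s))$ stands for $\exists z\,(z=Y(s)\wedge p(z))$ and the variables $s,z$ are fresh; \item $\langle x'=f(x)\,\&\,Q\rangle\exists y\,\varphi\leftrightarrow\exists y\,\langle x'=f(x)\,\&\,Q\rangle\varphi$ for $y$ not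 occurring in $x,f$ and not free in $Q$; \item $[x'=f(x)\,\&\,Q]\varphi\leftrightarrow\exists y\,[x'=f(x),y'=a(x)y+b(x)\,\&\,Q]\varphi$;\quad $[x'=f(x)\,\&\,Q]\varphi\to\forall y\,[x'=f(x),y'=g(x,y)\,\&\,Q]\varphi$; \item $[x'=f(x),y'=g(x,y)\,\&\,Q]\,\|y\|^2\le p(x)\to\big([x'=f(x)\,\&\,Q]\varphi\leftrightarrow[x'=f(x),y'=g(x,y)\,\&\,Q]\varphi\big)$ for a vector $y$ and $Q$ in first-order real arithmetic; \item $[x'=f(x)\,\&\,\chi]\varphi\leftrightarrow\forall t_0\big(t_0=c\to[x'=f(x)]([x'=-f(x)](c\ge t_0\to\chi)\to\varphi)\big)$ if the system contains the clock $c'=1$ and $t_0$ is fresh; \item $[x'=f(x)\,\&\,Q]\varphi\leftrightarrow\big(Q\to\varphi\wedge[x'=f(x)\,\&\,Q]\varphi\big)$; \item $\langle x'=f(x)\,\&\,Q_1\rangle\varphi\wedge\langle x'=f(x)\,\&\,Q_2\rangle\varphi\leftrightarrow\langle x'=f(x)\,\&\,Q_1\wedge Q_2\rangle\varphi$; \item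 $x=y\wedge f(x)\ne0\to\big(\langle x'=f(x)\,\&\,e>0\rangle x\ne y\leftrightarrow e>0\big)$; \item $\langle x'=f(x)\,\&\,Q(x)\rangle x=y\leftrightarrow\langle y'=-f(y)\,\&\,Q(y)\rangle y=x$; \item $[x'=f(x)]\varphi\leftrightarrow\forall y\,[x'=f(x)\,\&\,\varphi\vee x=y]\big(x=y\to\varphi\wedge\langle x'=f(x)\,\&\,\varphi\vee x=y\rangle x\ne y\big)$ if the system contains a clock $c'=1$; \item $[x'=f(x)\,\&\,Q](p)'\succeq'0\to\big([x'=f(x)\,\&\,Q]\,p\succeq0\leftrightarrow(Q\to p\succeq0)\big)$, where $(p)'$ is the Lie derivative of the term $p$ along $f$ and $(\succeq',\succeq)$ is $(\ge,\ge)$, $(\ge,>)$ or $(=,=)$. \end{itemize} \textbf{Lemma.} Let $x'=f(x)$ be any system of differential equations, $P,P_1,P_2,Q,Q_1,Q_2$ any formulas and $e$ any term. In (Stuck) and (IVT) let $t$ be a variable that is not bound by $x'=f(x)$, and let $t_0$ and $\tau$ be terms (for instance variables) in which neither $t$ nor a variable bound by $x'=f(x)$ occurs. Then the following formulas are derivable: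 \begin{itemize} \item (Rev) $P\to[x'=f(x)\,\&\,Q]\langle x'=-f(x)\,\&\,Q\rangle P$; \item (Stuck) $t=t_0\to\big([x'=f(x),t'=1\,\&\,t\le t_0]P\leftrightarrow P\big)$; \item (Idem) $\langle x'=f(x)\,\&\,Q\rangle P\to\langle x'=f(x)\,\&\,Q\wedge\langle x'=f(x)\,\&\,Q\rangle P\rangle P$; \item (Uniq') $\langle x'=f(x)\,\&\,Q_1\rangle P_1\wedge\langle x'=f(x)\,\&\,Q_2\rangle P_2\to\langle x'=f(x)\,\&\,Q_1\wedge Q_2\rangle\big(P_1\wedge\langle x'=f(x)\,\&\,Q_2\rangle P_2\big)\vee\langle x'=f(x)\,\&\,Q_1\wedge Q_2\rangle\big(P_2\wedge\langle x'=f(x)\,\&\,Q_1\rangle P_1\big)$; \item (IVT) $e\le0\wedge\langle x'=f(x),t'=1\,\&\,Q\rangle(t=\tau\wedge e>0)\to\langle x'=f(x),t'=1\,\&\,Q\wedge t<\tau\wedge e\le0\rangle\,e=0$. \end{itemize} -/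

import Mathlib

/-! Differential dynamic logic (its continuous fragment with rich tests): syntax, semantics and
proof calculus. -/

namespace DL

/-! ### Syntax -/

abbrev Var := ℕ

/-- Terms are polynomials over the variables with rational coefficients. -/
abbrev Term := MvPolynomial Var ℚ

/-- The term consisting of the variable `v`. -/
noncomputable abbrev tv (v : Var) : Term := MvPolynomial.X v

/-- Comparison relations. -/
inductive Cmp
  | eq | ne | ge | gt | le | lt

/-- A system of ordinary differential equations `v' = rhs v`, one for each `v ∈ vars`. All other
variables are constant along the system, so `rhs` is normalized to `0` there (two systems with the
same variables and the same right-hand sides are then equal). -/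
@[ext]
structure ODE where
  vars : Finset Var
  rhs : Var → Term
  rhs_off : ∀ v, v ∉ vars → rhs v = 0

/-- Formulas. `box α Q φ` is `[α & Q] φ` and `dia α Q φ` is `⟨α & Q⟩ φ`; the domain constraint
`Q` is an arbitrary formula. -/
inductive Formula
  | cmp (r : Cmp) (p q : Term)
  | and (φ ψ : Formula)
  | or (φ ψ : Formula)
  | not (φ : Formula)
  | all (x : Var) (φ : Formula)
  | ex (x : Var) (φ : Formula)
  | box (α : ODE) (Q φ : Formula)
  | dia (α : ODE) (Q φ : Formula)

namespace ODE

/-- The system `v' = p`. -/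
noncomputable def single (v : Var) (p : Term) : ODE where
  vars := {v}
  rhs := Function.update 0 v p
  rhs_off u hu := by
    rw [Function.update_of_ne (fun h => hu (by simp [h]))]
    rfl

/-- The reversed system `x' = -f(x)`. -/
noncomputable def neg (α : ODE) : ODE where
  vars := α.vars
  rhs v := -α.rhs v
  rhs_off v hv := by rw [α.rhs_off v hv, neg_zero]

/-- The joint system `x' = f(x), y' = g(x, y)`; only used for systems with disjoint variables. -/
noncomputable def join (α β : ODE) : ODE where
  vars := α.vars ∪ β.vars
  rhs v := α.rhs v + β.rhs v
  rhs_off v hv := by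
    rw [Finset.mem_union, not_or] at hv
    rw [α.rhs_off v hv.1, β.rhs_off v hv.2, add_zero]

/-- The joint system `x' = f(x), t' = 1`. -/
noncomputable def withClock (α : ODE) (t : Var) : ODE := α.join (single t 1)

/-- Simultaneous renaming of all variables. -/
noncomputable def rename (σ : Equiv.Perm Var) (α : ODE) : ODE where
  vars := α.vars.map σ.toEmbedding
  rhs v := MvPolynomial.rename σ (α.rhs (σ.symm v))
  rhs_off v hv := by
    have h : σ.symm v ∉ α.vars := fun h => hv (Finset.mem_map.2 ⟨_, h, by simp⟩)
    rw [α.rhs_off _ h, map_zero]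

/-- Substitution of `θ` for `x` in the right-hand sides. -/
noncomputable def subst (x : Var) (θ : Term) (α : ODE) : ODE where
  vars := α.vars
  rhs v := MvPolynomial.bind₁ (Function.update tv x θ) (α.rhs v)
  rhs_off v hv := by rw [α.rhs_off v hv, map_zero]

/-- The variables that occur in the system; those in `vars` are its bound variables. -/
noncomputable def fv (α : ODE) : Finset Var :=
  α.vars ∪ α.vars.biUnion fun v => (α.rhs v).vars

/-- The Lie derivative of a term along the system: the derivation with `v ↦ rhs v`. -/
noncomputable def lie (α : ODE) (p : Term) : Term := MvPolynomial.mkDerivation ℚ α.rhs p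

end ODE

namespace Formula

noncomputable def eq (p q : Term) : Formula := cmp .eq p q
noncomputable def ge (p q : Term) : Formula := cmp .ge p q
noncomputable def gt (p q : Term) : Formula := cmp .gt p q
noncomputable def le (p q : Term) : Formula := cmp .le p q
noncomputable def lt (p q : Term) : Formula := cmp .lt p q

/-- Truth. The program `x' = f(x)` without domain constraint is `x' = f(x) & tt`. -/
noncomputable def tt : Formula := eq 0 0

def imp (φ ψ : Formula) : Formula := or (not φ) ψ
def iff (φ ψ : Formula) : Formula := and (imp φ ψ) (imp ψ φ)

/-- The conjunction of the equations `a v = b v` for `v ∈ S`; `eqs S a b` is the equation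
`a = b` between vectors of terms indexed by `S`. -/
noncomputable def eqs (S : Finset Var) (a b : Var → Term) : Formula :=
  ((S.sort (· ≤ ·)).map fun v => eq (a v) (b v)).foldr and tt

/-- Quantification over the vector of the variables `σ v`, `v ∈ S`. -/
def allVec (S : Finset Var) (σ : Equiv.Perm Var) (φ : Formula) : Formula :=
  ((S.sort (· ≤ ·)).map σ).foldr all φ

/-- Quantification over the vector of the variables `σ v`, `v ∈ S`. -/
def exVec (S : Finset Var) (σ : Equiv.Perm Var) (φ : Formula) : Formula :=
  ((S.sort (· ≤ ·)).map σ).foldr ex φ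

/-- The free variables. -/
noncomputable def fv : Formula → Finset Var
  | cmp _ p q => p.vars ∪ q.vars
  | and φ ψ => φ.fv ∪ ψ.fv
  | or φ ψ => φ.fv ∪ ψ.fv
  | not φ => φ.fv
  | all x φ => φ.fv.erase x
  | ex x φ => φ.fv.erase x
  | box α Q φ => α.fv ∪ Q.fv ∪ φ.fv
  | dia α Q φ => α.fv ∪ Q.fv ∪ φ.fv

/-- Formulas of first-order real arithmetic. -/
def IsFOL : Formula → Prop
  | cmp _ _ _ => True
  | and φ ψ => φ.IsFOL ∧ ψ.IsFOL
  | or φ ψ => φ.IsFOL ∧ ψ.IsFOL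
  | not φ => φ.IsFOL
  | all _ φ => φ.IsFOL
  | ex _ φ => φ.IsFOL
  | box _ _ _ => False
  | dia _ _ _ => False

/-- Simultaneous renaming of all variables, free and bound. -/
noncomputable def rename (σ : Equiv.Perm Var) : Formula → Formula
  | cmp r p q => cmp r (MvPolynomial.rename σ p) (MvPolynomial.rename σ q)
  | and φ ψ => and (φ.rename σ) (ψ.rename σ)
  | or φ ψ => or (φ.rename σ) (ψ.rename σ)
  | not φ => not (φ.rename σ)
  | all x φ => all (σ x) (φ.rename σ)
  | ex x φ => ex (σ x) (φ.rename σ)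
  | box α Q φ => box (α.rename σ) (Q.rename σ) (φ.rename σ)
  | dia α Q φ => dia (α.rename σ) (Q.rename σ) (φ.rename σ)

/-- Substitution of the term `θ` for the free occurrences of the variable `x`; meaningful if
`Admissible x θ` holds. -/
noncomputable def subst (x : Var) (θ : Term) : Formula → Formula
  | cmp r p q => cmp r (MvPolynomial.bind₁ (Function.update tv x θ) p)
      (MvPolynomial.bind₁ (Function.update tv x θ) q)
  | and φ ψ => and (φ.subst x θ) (ψ.subst x θ)
  | or φ ψ => or (φ.subst x θ) (ψ.subst x θ)
  | not φ => not (φ.subst x θ)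
  | all z φ => if z = x then all z φ else all z (φ.subst x θ)
  | ex z φ => if z = x then ex z φ else ex z (φ.subst x θ)
  | box α Q φ => box (α.subst x θ) (Q.subst x θ) (φ.subst x θ)
  | dia α Q φ => dia (α.subst x θ) (Q.subst x θ) (φ.subst x θ)

/-- No free occurrence of `x` lies in the scope of a quantifier or a differential equation that
binds `x` or a variable of `θ`. -/
def Admissible (x : Var) (θ : Term) : Formula → Prop
  | cmp _ _ _ => True
  | and φ ψ => φ.Admissible x θ ∧ ψ.Admissible x θ
  | or φ ψ => φ.Admissible x θ ∧ ψ.Admissible x θ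
  | not φ => φ.Admissible x θ
  | all z φ => x ∉ (all z φ).fv ∨ (z ∉ θ.vars ∧ φ.Admissible x θ)
  | ex z φ => x ∉ (ex z φ).fv ∨ (z ∉ θ.vars ∧ φ.Admissible x θ)
  | box α Q φ => x ∉ (box α Q φ).fv ∨
      (x ∉ α.vars ∧ Disjoint θ.vars α.vars ∧ Q.Admissible x θ ∧ φ.Admissible x θ)
  | dia α Q φ => x ∉ (dia α Q φ).fv ∨
      (x ∉ α.vars ∧ Disjoint θ.vars α.vars ∧ Q.Admissible x θ ∧ φ.Admissible x θ)

end Formula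

/-! ### Semantics -/

abbrev State := Var → ℝ

/-- The value of a term in a state. -/
noncomputable def val (ω : State) (p : Term) : ℝ := MvPolynomial.aeval ω p

def Cmp.rel : Cmp → ℝ → ℝ → Prop
  | .eq => (· = ·)
  | .ne => (· ≠ ·)
  | .ge => (· ≥ ·)
  | .gt => (· > ·)
  | .le => (· ≤ ·)
  | .lt => (· < ·)

/-- `Φ` solves the system on `[0, τ]` with initial state `ω`; variables without a differential
equation have derivative `0`, so they stay constant. -/
def ODE.IsSolution (α : ODE) (ω : State) (τ : ℝ) (Φ : ℝ → State) : Prop :=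
  Φ 0 = ω ∧ ∀ ξ ∈ Set.Icc 0 τ, ∀ v,
    HasDerivWithinAt (fun s => Φ s v) (val (Φ ξ) (α.rhs v)) (Set.Icc 0 τ) ξ

/-- `Sat φ ω` means that `φ` is true in the state `ω`. -/
def Sat : Formula → State → Prop
  | .cmp r p q, ω => r.rel (val ω p) (val ω q)
  | .and φ ψ, ω => Sat φ ω ∧ Sat ψ ω
  | .or φ ψ, ω => Sat φ ω ∨ Sat ψ ω
  | .not φ, ω => ¬ Sat φ ω
  | .all x φ, ω => ∀ r : ℝ, Sat φ (Function.update ω x r)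
  | .ex x φ, ω => ∃ r : ℝ, Sat φ (Function.update ω x r)
  | .box α Q φ, ω => ∀ τ : ℝ, 0 ≤ τ → ∀ Φ : ℝ → State, α.IsSolution ω τ Φ →
      (∀ ξ ∈ Set.Icc 0 τ, Sat Q (Φ ξ)) → Sat φ (Φ τ)
  | .dia α Q φ, ω => ∃ τ : ℝ, 0 ≤ τ ∧ ∃ Φ : ℝ → State, α.IsSolution ω τ Φ ∧
      (∀ ξ ∈ Set.Icc 0 τ, Sat Q (Φ ξ)) ∧ Sat φ (Φ τ)

/-! ### Proof calculus -/

open Formula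

/-- With `x` the vector of the variables in `S`, the vector `y` with entries `y v = σ v` is a
vector of distinct variables outside of `S` and `V`, and the renaming `σ` of `x` to `y` does not
change the other variables in `V`. -/
def FreshCopy (σ : Equiv.Perm Var) (S V : Finset Var) : Prop :=
  (∀ v ∈ S, σ v ∉ S ∪ V) ∧ ∀ v ∈ V \ S, σ v = v

/-- `IsInstance x φ ψ`: reading `φ` as `p(x)`, the formula `ψ` is `p(θ)` for a term `θ`. If `θ` is
a variable `y` that is not free in `∀ x p(x)`, then `p(y)` may also be obtained by renaming, so
that `x` may be bound by differential equations inside `p(x)`. -/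
inductive IsInstance (x : Var) (φ : Formula) : Formula → Prop
  | term (θ : Term) (h : φ.Admissible x θ) : IsInstance x φ (φ.subst x θ)
  | var (y : Var) (h : y ∉ (all x φ).fv) : IsInstance x φ (φ.rename (Equiv.swap x y))

/-- The axiom schemata. Vectors of variables `y` are given as `σ v`, `v ∈ α.vars`, see
`FreshCopy`. -/
inductive Ax : Formula → Prop
  /-- `⟨α & Q⟩φ ↔ ¬[α & Q]¬φ` -/
  | diamond (α : ODE) (Q φ : Formula) :
      Ax (iff (dia α Q φ) (not (box α Q (not φ))))
  /-- `⟨x' = f(x)⟩p(x) ↔ ∃ s ≥ 0 ⟨x := Y(s)⟩p(x)` for a polynomial solution `Y(s)` of the symbolic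
  initial value problem `Y' = f(Y)`, `Y(0) = x`. The assignment is expressed as
  `∃ z (z = Y(s) ∧ p(z))`. -/
  | evolve (α : ODE) (φ : Formula) (s : Var) (Y : Var → Term) (σ : Equiv.Perm Var)
      (hs : s ∉ α.fv ∪ φ.fv)
      (hσ : FreshCopy σ α.vars
        (insert s (α.fv ∪ φ.fv ∪ α.vars.biUnion fun v => (Y v).vars)))
      (hY : ∀ v ∈ α.vars, MvPolynomial.pderiv s (Y v) =
        MvPolynomial.bind₁ (fun u => if u ∈ α.vars then Y u else tv u) (α.rhs v))
      (hY0 : ∀ v ∈ α.vars, MvPolynomial.bind₁ (Function.update tv s 0) (Y v) = tv v) :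
      Ax (iff (dia α tt φ) (ex s (and (ge (tv s) 0)
        (exVec α.vars σ (and (eqs α.vars (fun v => tv (σ v)) Y) (φ.rename σ))))))
  /-- `⟨α & Q⟩∃y φ ↔ ∃y⟨α & Q⟩φ` -/
  | barcan (α : ODE) (Q φ : Formula) (y : Var) (hy : y ∉ α.fv ∪ Q.fv) :
      Ax (iff (dia α Q (ex y φ)) (ex y (dia α Q φ)))
  /-- `[α & Q](φ → ψ) → ([α & Q]φ → [α & Q]ψ)` -/
  | kripke (α : ODE) (Q φ ψ : Formula) :
      Ax (imp (box α Q (imp φ ψ)) (imp (box α Q φ) (box α Q ψ)))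
  /-- `φ → [α & Q]φ` if no free variable of `φ` is bound by `α` -/
  | vacuous (α : ODE) (Q φ : Formula) (h : Disjoint φ.fv α.vars) :
      Ax (imp φ (box α Q φ))
  /-- differential ghosts: `[x' = f(x) & Q]φ ↔ ∃y [x' = f(x), y' = a(x) y + b(x) & Q]φ` -/
  | ghost (α : ODE) (Q φ : Formula) (y : Var) (a b : Term)
      (hy : y ∉ α.fv ∪ Q.fv ∪ φ.fv ∪ a.vars ∪ b.vars) :
      Ax (iff (box α Q φ) (ex y (box (α.join (ODE.single y (a * tv y + b))) Q φ)))
  /-- `[x' = f(x) & Q]φ → ∀y [x' = f(x), y' = g(x, y) & Q]φ` -/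
  | ghostAll (α : ODE) (Q φ : Formula) (y : Var) (g : Term)
      (hy : y ∉ α.fv ∪ Q.fv ∪ φ.fv) :
      Ax (imp (box α Q φ) (all y (box (α.join (ODE.single y g)) Q φ)))
  /-- bounded differential ghosts:
  `[x' = f(x), y' = g(x, y) & Q]‖y‖² ≤ p(x) →`
  `([x' = f(x) & Q]φ ↔ [x' = f(x), y' = g(x, y) & Q]φ)` -/
  | boundedGhost (α β : ODE) (Q φ : Formula) (p : Term) (hQ : Q.IsFOL)
      (hβ : Disjoint β.vars (α.fv ∪ Q.fv ∪ φ.fv ∪ p.vars)) :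
      Ax (imp (box (α.join β) Q (le (∑ y ∈ β.vars, tv y ^ 2) p))
        (iff (box α Q φ) (box (α.join β) Q φ)))
  /-- there and back, for a clock `c' = 1` of the system:
  `[x' = θ & χ]φ ↔ ∀ t₀ = c [x' = θ]([x' = -θ](c ≥ t₀ → χ) → φ)` -/
  | thereAndBack (α : ODE) (χ φ : Formula) (c t₀ : Var) (hc : c ∈ α.vars) (hc1 : α.rhs c = 1)
      (ht : t₀ ∉ α.fv ∪ χ.fv ∪ φ.fv) :
      Ax (iff (box α χ φ) (all t₀ (imp (eq (tv t₀) (tv c))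
        (box α tt (imp (box α.neg tt (imp (ge (tv c) (tv t₀)) χ)) φ)))))
  /-- differential skip: `[α & Q]φ ↔ (Q → φ ∧ [α & Q]φ)` -/
  | skip (α : ODE) (Q φ : Formula) :
      Ax (iff (box α Q φ) (imp Q (and φ (box α Q φ))))
  /-- uniqueness: `⟨α & Q₁⟩φ ∧ ⟨α & Q₂⟩φ ↔ ⟨α & Q₁ ∧ Q₂⟩φ` -/
  | uniq (α : ODE) (Q₁ Q₂ φ : Formula) :
      Ax (iff (and (dia α Q₁ φ) (dia α Q₂ φ)) (dia α (and Q₁ Q₂) φ))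
  /-- continuity: `x = y ∧ f(x) ≠ 0 → (⟨x' = f(x) & e > 0⟩ x ≠ y ↔ e > 0)` -/
  | cont (α : ODE) (e : Term) (σ : Equiv.Perm Var)
      (hσ : FreshCopy σ α.vars (α.fv ∪ e.vars)) :
      Ax (imp (and (eqs α.vars tv (fun v => tv (σ v))) (not (eqs α.vars α.rhs 0)))
        (iff (dia α (gt e 0) (not (eqs α.vars tv (fun v => tv (σ v))))) (gt e 0)))
  /-- `⟨x' = f(x) & Q(x)⟩ x = y ↔ ⟨y' = -f(y) & Q(y)⟩ y = x` -/
  | adjoint (α : ODE) (Q : Formula) (σ : Equiv.Perm Var)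
      (hσ : FreshCopy σ α.vars (α.fv ∪ Q.fv)) :
      Ax (iff (dia α Q (eqs α.vars tv (fun v => tv (σ v))))
        (dia (α.neg.rename σ) (Q.rename σ) (eqs α.vars (fun v => tv (σ v)) tv)))
  /-- real induction, for systems with a clock `c' = 1`:
  `[x' = f(x)]φ ↔ ∀y [x' = f(x) & φ ∨ x = y](x = y → φ ∧ ⟨x' = f(x) & φ ∨ x = y⟩ x ≠ y)` -/
  | realInduction (α : ODE) (φ : Formula) (σ : Equiv.Perm Var)
      (hc : ∃ c ∈ α.vars, α.rhs c = 1) (hσ : FreshCopy σ α.vars (α.fv ∪ φ.fv)) :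
      Ax (iff (box α tt φ) (allVec α.vars σ
        (box α (or φ (eqs α.vars tv (fun v => tv (σ v))))
          (imp (eqs α.vars tv (fun v => tv (σ v)))
            (and φ (dia α (or φ (eqs α.vars tv (fun v => tv (σ v))))
              (not (eqs α.vars tv (fun v => tv (σ v))))))))))
  /-- differential invariants: `[α & Q](p)' ≥ 0 → ([α & Q]p ≥ 0 ↔ (Q → p ≥ 0))` -/
  | invGe (α : ODE) (Q : Formula) (p : Term) :
      Ax (imp (box α Q (ge (α.lie p) 0)) (iff (box α Q (ge p 0)) (imp Q (ge p 0))))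
  /-- differential invariants: `[α & Q](p)' ≥ 0 → ([α & Q]p > 0 ↔ (Q → p > 0))` -/
  | invGt (α : ODE) (Q : Formula) (p : Term) :
      Ax (imp (box α Q (ge (α.lie p) 0)) (iff (box α Q (gt p 0)) (imp Q (gt p 0))))
  /-- differential invariants: `[α & Q](p)' = 0 → ([α & Q]p = 0 ↔ (Q → p = 0))` -/
  | invEq (α : ODE) (Q : Formula) (p : Term) :
      Ax (imp (box α Q (eq (α.lie p) 0)) (iff (box α Q (eq p 0)) (imp Q (eq p 0))))

/-- The sequent calculus: `Proves Γ Δ` means that the sequent `Γ ⊢ Δ` (the conjunction of `Γ`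
implies the disjunction of `Δ`) has a proof. -/
inductive Proves : List Formula → List Formula → Prop
  | ax {φ : Formula} (h : Ax φ) : Proves [] [φ]
  /-- structural rules: exchange, contraction and weakening -/
  | structural {Γ Γ' Δ Δ' : List Formula} (hΓ : Γ ⊆ Γ') (hΔ : Δ ⊆ Δ') (h : Proves Γ Δ) :
      Proves Γ' Δ'
  | id {Γ Δ : List Formula} {φ : Formula} : Proves (φ :: Γ) (φ :: Δ)
  | cut {Γ Δ : List Formula} {φ : Formula} (h₁ : Proves Γ (φ :: Δ)) (h₂ : Proves (φ :: Γ) Δ) :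
      Proves Γ Δ
  | notL {Γ Δ : List Formula} {φ : Formula} (h : Proves Γ (φ :: Δ)) : Proves (not φ :: Γ) Δ
  | notR {Γ Δ : List Formula} {φ : Formula} (h : Proves (φ :: Γ) Δ) : Proves Γ (not φ :: Δ)
  | andL {Γ Δ : List Formula} {φ ψ : Formula} (h : Proves (φ :: ψ :: Γ) Δ) :
      Proves (and φ ψ :: Γ) Δ
  | andR {Γ Δ : List Formula} {φ ψ : Formula} (h₁ : Proves Γ (φ :: Δ)) (h₂ : Proves Γ (ψ :: Δ)) :
      Proves Γ (and φ ψ :: Δ)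
  | orL {Γ Δ : List Formula} {φ ψ : Formula} (h₁ : Proves (φ :: Γ) Δ) (h₂ : Proves (ψ :: Γ) Δ) :
      Proves (or φ ψ :: Γ) Δ
  | orR {Γ Δ : List Formula} {φ ψ : Formula} (h : Proves Γ (φ :: ψ :: Δ)) :
      Proves Γ (or φ ψ :: Δ)
  | impL {Γ Δ : List Formula} {φ ψ : Formula} (h₁ : Proves Γ (φ :: Δ)) (h₂ : Proves (ψ :: Γ) Δ) :
      Proves (imp φ ψ :: Γ) Δ
  | impR {Γ Δ : List Formula} {φ ψ : Formula} (h : Proves (φ :: Γ) (ψ :: Δ)) :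
      Proves Γ (imp φ ψ :: Δ)
  | allL {Γ Δ : List Formula} {x : Var} {φ ψ : Formula} (hψ : IsInstance x φ ψ)
      (h : Proves (ψ :: Γ) Δ) : Proves (all x φ :: Γ) Δ
  | allR {Γ Δ : List Formula} {x : Var} {φ : Formula} (y : Var)
      (hy : ∀ χ ∈ all x φ :: (Γ ++ Δ), y ∉ χ.fv)
      (h : Proves Γ (φ.rename (Equiv.swap x y) :: Δ)) : Proves Γ (all x φ :: Δ)
  | exL {Γ Δ : List Formula} {x : Var} {φ : Formula} (y : Var)
      (hy : ∀ χ ∈ ex x φ :: (Γ ++ Δ), y ∉ χ.fv)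
      (h : Proves (φ.rename (Equiv.swap x y) :: Γ) Δ) : Proves (ex x φ :: Γ) Δ
  | exR {Γ Δ : List Formula} {x : Var} {φ ψ : Formula} (hψ : IsInstance x φ ψ)
      (h : Proves Γ (ψ :: Δ)) : Proves Γ (ex x φ :: Δ)
  /-- replacing equals by equals: `x = y, φ ⊢ φ'`, where `φ'` results from `φ` by interchanging
  the variables `x` and `y` -/
  | eqRename (x y : Var) (φ : Formula) :
      Proves [eq (tv x) (tv y), φ] [φ.rename (Equiv.swap x y)]
  /-- real arithmetic: every sequent that is valid in first-order real arithmetic -/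
  | real {Γ Δ : List Formula} (hΓ : ∀ φ ∈ Γ, φ.IsFOL) (hΔ : ∀ φ ∈ Δ, φ.IsFOL)
      (h : ∀ ω : State, (∀ φ ∈ Γ, Sat φ ω) → ∃ φ ∈ Δ, Sat φ ω) : Proves Γ Δ
  /-- generalization -/
  | gen {Γ Δ : List Formula} {α : ODE} {Q φ : Formula} (h : Proves [] [φ]) :
      Proves Γ (box α Q φ :: Δ)
  /-- differential weakening -/
  | dW {Γ Δ : List Formula} {α : ODE} {Q φ : Formula} (h : Proves [Q] [φ]) :
      Proves Γ (box α Q φ :: Δ)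
  /-- differential cut -/
  | dC {Γ Δ : List Formula} {α : ODE} {Q χ φ : Formula} (h₁ : Proves Γ (box α Q χ :: Δ))
      (h₂ : Proves Γ (box α (and Q χ) φ :: Δ)) : Proves Γ (box α Q φ :: Δ)

/-- `φ` is derivable. -/
def Derivable (φ : Formula) : Prop := Proves [] [φ]

end DL

/-! The proof works in a canonical model instead of writing sequent derivations. A `World` is a
prime theory, and by Lindenbaum's lemma a sequent is derivable exactly when every world respects it.
Connectives have their usual meaning in a world, and since `[α & Q]` is a normal modality, a box
holds at `w` iff its body holds at all worlds related to `w` by `Acc α Q` (`World.box_iff`). No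
solution theory is used: semantics enters only through valid sequents of real arithmetic, and the
axioms become properties of `Acc`.

Uniqueness says that domain constraints intersect (`Acc.and_iff`), and adjointness says that `α.neg`
gives the converse relation (`Acc.neg`), which is (Rev). A differential cut on the reversed run
shows that each intermediate world still reaches the end (`Acc.remaining`), which is (Idem). If a
clock `c` may not exceed its initial value `τ`, a differential invariant pins all variables to their
initial values (`Acc.of_stuck`), which is (Stuck).

For (IVT), there-and-back turns a domain constraint into a condition on the endpoint
(`Acc.iff_past`), so that real induction extends to constrained systems
(`box_of_realInduction_domain`). If `e = 0` were never reached, this induction with continuity would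
keep `e < 0` up to time `τ`. For (Uniq'), a ghost clock is added and the end times of the two runs
are compared. By (IVT) the longer run passes through the end time of the shorter one, where
uniqueness identifies the two.

Worlds need not contain witnesses for existential formulas. Auxiliary values are named by fresh
variables instead, at the price of passing to another world. -/

namespace DL

open Formula

/-! ### Renaming -/

theorem ODE.rename_refl (α : ODE) : α.rename (Equiv.refl Var) = α := by
  ext1
  · simp [ODE.rename]
  · funext v
    simp [ODE.rename]

theorem ODE.rename_rename (σ ρ : Equiv.Perm Var) (α : ODE) :
    (α.rename σ).rename ρ = α.rename (ρ * σ) := by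
  ext1
  · ext v
    simp [ODE.rename]
    rfl
  · funext v
    simp only [ODE.rename, MvPolynomial.rename_rename]
    rfl

theorem Formula.rename_refl (φ : Formula) : φ.rename (Equiv.refl Var) = φ := by
  induction φ <;> simp_all [Formula.rename, ODE.rename_refl]

theorem Formula.rename_rename (σ ρ : Equiv.Perm Var) (φ : Formula) :
    (φ.rename σ).rename ρ = φ.rename (ρ * σ) := by
  induction φ <;> simp_all [Formula.rename, ODE.rename_rename, MvPolynomial.rename_rename]

theorem ODE.fv_rename (σ : Equiv.Perm Var) (α : ODE) : (α.rename σ).fv ⊆ α.fv.image σ := by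
  intro u hu
  simp only [ODE.fv, ODE.rename, Finset.mem_union, Finset.mem_biUnion, Finset.mem_map,
    Finset.mem_image] at hu ⊢
  rcases hu with ⟨a, ha, rfl⟩ | ⟨a, ⟨b, hb, rfl⟩, ha⟩
  · exact ⟨a, Or.inl ha, rfl⟩
  · have h := MvPolynomial.vars_rename _ _ ha
    simp only [Finset.mem_image] at h
    obtain ⟨c, hc, rfl⟩ := h
    exact ⟨c, Or.inr ⟨b, hb, by simpa using hc⟩, rfl⟩

theorem Formula.fv_rename (σ : Equiv.Perm Var) (φ : Formula) :
    (φ.rename σ).fv ⊆ φ.fv.image σ := by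
  induction φ with
  | cmp r p q =>
    simp only [Formula.rename, Formula.fv, Finset.image_union]
    exact Finset.union_subset_union (MvPolynomial.vars_rename _ _) (MvPolynomial.vars_rename _ _)
  | and φ ψ h₁ h₂ | or φ ψ h₁ h₂ =>
    simp only [Formula.rename, Formula.fv, Finset.image_union]
    exact Finset.union_subset_union h₁ h₂
  | not φ h => exact h
  | all x φ h | ex x φ h =>
    intro u hu
    simp only [Formula.rename, Formula.fv, Finset.mem_erase] at hu
    obtain ⟨a, ha, rfl⟩ := Finset.mem_image.1 (h hu.2)
    exact Finset.mem_image_of_mem _ (Finset.mem_erase.2 ⟨fun e => hu.1 (by rw [e]), ha⟩)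
  | box α Q φ h₁ h₂ | dia α Q φ h₁ h₂ =>
    simp only [Formula.rename, Formula.fv, Finset.image_union]
    exact Finset.union_subset_union (Finset.union_subset_union (ODE.fv_rename _ _) h₁) h₂

/-! ### Systems -/

theorem ODE.neg_neg (α : ODE) : α.neg.neg = α := by
  ext1
  · rfl
  · funext v
    simp [ODE.neg]

theorem ODE.fv_neg (α : ODE) : α.neg.fv = α.fv := by
  simp [ODE.fv, ODE.neg, MvPolynomial.vars_neg]

theorem ODE.lie_of_disjoint (α : ODE) (p : Term) (h : Disjoint p.vars α.vars) : α.lie p = 0 := by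
  refine MvPolynomial.derivation_eq_zero_of_forall_mem_vars fun v hv => ?_
  simpa using α.rhs_off v (Finset.disjoint_left.1 h hv)

theorem ODE.lie_tv (α : ODE) (v : Var) : α.lie (tv v) = α.rhs v :=
  MvPolynomial.mkDerivation_X _ _ _

theorem ODE.lie_sub (α : ODE) (p q : Term) : α.lie (p - q) = α.lie p - α.lie q :=
  map_sub _ _ _

theorem ODE.lie_mul (α : ODE) (p q : Term) : α.lie (p * q) = p * α.lie q + q * α.lie p := by
  simp [ODE.lie]

theorem sat_eqs (S : Finset Var) (a b : Var → Term) (ω : State) :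
    Sat (eqs S a b) ω ↔ ∀ v ∈ S, val ω (a v) = val ω (b v) := by
  have key : ∀ l : List Var, Sat ((l.map fun v => eq (a v) (b v)).foldr Formula.and tt) ω ↔
      ∀ v ∈ l, val ω (a v) = val ω (b v) := by
    intro l
    induction l with
    | nil => simp [tt, Formula.eq, Sat, Cmp.rel]
    | cons x l ih => simpa [Sat, Formula.eq, Cmp.rel] using fun _ => ih
  simp [eqs, key]

theorem isFOL_eqs (S : Finset Var) (a b : Var → Term) : (eqs S a b).IsFOL := by
  have key : ∀ l : List Var, ((l.map fun v => eq (a v) (b v)).foldr Formula.and tt).IsFOL := by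
    intro l
    induction l with
    | nil => trivial
    | cons x l ih => exact ⟨trivial, ih⟩
  exact key _

/-! ### Worlds -/

/-- A prime theory: a set of formulas closed under the derivable sequents. -/
structure World where
  holds : Formula → Prop
  closed : ∀ {Γ Δ : List Formula}, Proves Γ Δ → (∀ γ ∈ Γ, holds γ) → ∃ δ ∈ Δ, holds δ

instance : CoeFun World fun _ => Formula → Prop := ⟨World.holds⟩

/-- Lindenbaum's lemma: Zorn gives a maximal `M ⊇ G` that does not prove `Δ`. Primeness comes from
cut: a formula outside `M` proves `Δ` together with finitely many members of `M`, so formulas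
outside `M` can be cut from a succedent one at a time. -/
theorem exists_world {G : Set Formula} {Δ : List Formula}
    (h : ∀ Γ : List Formula, (∀ γ ∈ Γ, γ ∈ G) → ¬ Proves Γ Δ) :
    ∃ w : World, (∀ γ ∈ G, w γ) ∧ ∀ δ ∈ Δ, ¬ w δ := by
  obtain ⟨M, hG, hM⟩ := zorn_subset_nonempty
    {M : Set Formula | ∀ Γ' : List Formula, (∀ γ ∈ Γ', γ ∈ M) → ¬ Proves Γ' Δ}
    (by
      intro c hc hchain hne
      refine ⟨⋃₀ c, ?_, fun s hs => Set.subset_sUnion_of_mem hs⟩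
      intro Γ' hΓ'
      have : ∃ s ∈ c, ∀ γ ∈ Γ', γ ∈ s := by
        clear h
        induction Γ' with
        | nil => exact ⟨_, hne.some_mem, by simp⟩
        | cons a l ih =>
          obtain ⟨s, hs, hl⟩ := ih fun γ hγ => hΓ' γ (List.mem_cons_of_mem _ hγ)
          obtain ⟨s', hs', ha⟩ := hΓ' a List.mem_cons_self
          rcases hchain.total hs hs' with hle | hle
          · exact ⟨s', hs', by
              intro γ hγ
              rcases List.mem_cons.1 hγ with rfl | hγ
              exacts [ha, hle (hl γ hγ)]⟩
          · exact ⟨s, hs, by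
              intro γ hγ
              rcases List.mem_cons.1 hγ with rfl | hγ
              exacts [hle ha, hl γ hγ]⟩
      obtain ⟨s, hs, hsub⟩ := this
      exact hc hs Γ' hsub)
    G h
  have key : ∀ Δ₁ : List Formula, (∀ δ ∈ Δ₁, δ ∉ M) →
      ∀ Γ₁ : List Formula, (∀ γ ∈ Γ₁, γ ∈ M) → ¬ Proves Γ₁ (Δ₁ ++ Δ) := by
    intro Δ₁
    induction Δ₁ with
    | nil => exact fun _ Γ₁ h₁ => hM.prop Γ₁ h₁
    | cons δ Δ₁ ih =>
      intro hΔ Γ₁ h₁ hp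
      have hδ : δ ∉ M := hΔ δ List.mem_cons_self
      obtain ⟨Γ₂, h₂, hp₂⟩ : ∃ Γ₂ : List Formula, (∀ γ ∈ Γ₂, γ ∈ M) ∧ Proves (δ :: Γ₂) Δ := by
        by_contra hcon
        push Not at hcon
        refine hδ (hM.le_of_ge (y := insert δ M) ?_ (Set.subset_insert _ _) (Set.mem_insert _ _))
        intro Γ' hΓ' hp'
        classical
        refine hcon (Γ'.filter (· ∈ M)) (by simp) (Proves.structural ?_ (List.Subset.refl _) hp')
        intro γ hγ
        rcases hΓ' γ hγ with rfl | hm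
        · exact List.mem_cons_self
        · exact List.mem_cons_of_mem _ (by simp [hγ, hm])
      refine ih (fun δ' hδ' => hΔ δ' (List.mem_cons_of_mem _ hδ')) (Γ₁ ++ Γ₂)
        (by simpa [or_imp, forall_and] using ⟨h₁, h₂⟩)
        (Proves.cut (φ := δ) (Proves.structural (by simp) (by simp) hp)
          (Proves.structural ?_ (by simp) hp₂))
      exact List.cons_subset_cons _ (by simp)
  refine ⟨⟨fun φ => φ ∈ M, fun {Γ₁ Δ₁} hp hΓ₁ => ?_⟩, fun γ hγ => hG hγ, fun δ hδ hm => ?_⟩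
  · by_contra hcon
    push Not at hcon
    exact key Δ₁ hcon Γ₁ hΓ₁ (Proves.structural (List.Subset.refl _) (by simp) hp)
  · exact hM.prop [δ] (by simpa using hm)
      (Proves.structural (List.Subset.refl _) (by simpa using hδ) (Proves.id (Δ := [])))

theorem proves_of_worlds {Γ Δ : List Formula}
    (h : ∀ w : World, (∀ γ ∈ Γ, w γ) → ∃ δ ∈ Δ, w δ) : Proves Γ Δ := by
  by_contra hp
  obtain ⟨w, h₁, h₂⟩ := exists_world (G := {γ | γ ∈ Γ}) (Δ := Δ) fun Γ' hΓ' hp' =>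
    hp (Proves.structural hΓ' (List.Subset.refl _) hp')
  obtain ⟨δ, hδ, hw⟩ := h w h₁
  exact h₂ δ hδ hw

theorem proves_one {φ ψ : Formula} (h : ∀ w : World, w φ → w ψ) : Proves [φ] [ψ] :=
  proves_of_worlds fun w hw => ⟨ψ, by simp, h w (hw φ (by simp))⟩

theorem derivable_of_worlds {φ : Formula} (h : ∀ w : World, w φ) : Derivable φ :=
  proves_of_worlds fun w _ => ⟨φ, by simp, h w⟩

namespace World

variable (w : World)

theorem of_proves {φ : Formula} (h : Proves [] [φ]) : w φ := by
  simpa using w.closed h (by simp)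

theorem of_proves_one {φ ψ : Formula} (h : Proves [φ] [ψ]) (hφ : w φ) : w ψ := by
  simpa using w.closed h (by simpa using hφ)

theorem of_ax {φ : Formula} (h : Ax φ) : w φ := w.of_proves (.ax h)

theorem not_iff {φ : Formula} : w (.not φ) ↔ ¬ w φ := by
  constructor
  · intro h₁ h₂
    simpa using w.closed (Proves.notL (Proves.id (Γ := []) (Δ := []) (φ := φ)))
      (by simpa using ⟨h₁, h₂⟩)
  · intro h
    have := w.closed (Proves.notR (Proves.id (Γ := []) (Δ := []) (φ := φ))) (by simp)
    simpa [h] using this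

theorem and_iff {φ ψ : Formula} : w (.and φ ψ) ↔ w φ ∧ w ψ := by
  constructor
  · intro h
    constructor
    · exact w.of_proves_one (.andL .id) h
    · exact w.of_proves_one (.andL (.structural (by simp) (List.Subset.refl _)
        (Proves.id (Γ := []) (Δ := [])))) h
  · rintro ⟨h₁, h₂⟩
    have := w.closed (Γ := [φ, ψ]) (Δ := [.and φ ψ]) (.andR .id
      (.structural (by simp) (List.Subset.refl _) (Proves.id (Γ := []) (Δ := []))))
      (by simpa using ⟨h₁, h₂⟩)
    simpa using this

theorem or_iff {φ ψ : Formula} : w (.or φ ψ) ↔ w φ ∨ w ψ := by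
  constructor
  · intro h
    have := w.closed (Γ := [.or φ ψ]) (Δ := [φ, ψ]) (.orL .id
      (.structural (List.Subset.refl _) (by simp) (Proves.id (Γ := []) (Δ := []))))
      (by simpa using h)
    simpa using this
  · rintro (h | h)
    · exact w.of_proves_one (.orR .id) h
    · exact w.of_proves_one (.orR (.structural (List.Subset.refl _) (by simp)
        (Proves.id (Γ := []) (Δ := [])))) h

theorem imp_iff {φ ψ : Formula} : w (.imp φ ψ) ↔ (w φ → w ψ) := by
  rw [Formula.imp, or_iff, not_iff]
  tauto

theorem iff_iff {φ ψ : Formula} : w (.iff φ ψ) ↔ (w φ ↔ w ψ) := by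
  rw [Formula.iff, and_iff, imp_iff, imp_iff]
  tauto

theorem fol {φ : Formula} (hφ : φ.IsFOL) (h : ∀ ω, Sat φ ω) : w φ :=
  w.of_proves (.real (by simp) (by simpa using hφ) fun ω _ => ⟨φ, by simp, h ω⟩)

theorem fol₁ {φ ψ : Formula} (h : ∀ ω, Sat φ ω → Sat ψ ω) (hw : w φ)
    (h₁ : φ.IsFOL := by first | exact trivial | exact isFOL_eqs _ _ _)
    (hψ : ψ.IsFOL := by first | exact trivial | exact isFOL_eqs _ _ _) : w ψ :=
  w.of_proves_one (.real (by simpa using h₁) (by simpa using hψ)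
    fun ω hω => ⟨ψ, by simp, h ω (hω φ (by simp))⟩) hw

theorem fol₂ {φ χ ψ : Formula} (h : ∀ ω, Sat φ ω → Sat χ ω → Sat ψ ω) (hw₁ : w φ) (hw₂ : w χ)
    (h₁ : φ.IsFOL := by first | exact trivial | exact isFOL_eqs _ _ _)
    (h₂ : χ.IsFOL := by first | exact trivial | exact isFOL_eqs _ _ _)
    (hψ : ψ.IsFOL := by first | exact trivial | exact isFOL_eqs _ _ _) : w ψ :=
  w.fol₁ (φ := .and φ χ) (fun ω hω => h ω hω.1 hω.2) (w.and_iff.2 ⟨hw₁, hw₂⟩) ⟨h₁, h₂⟩ hψ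

theorem tt_holds : w tt := w.fol trivial fun _ => rfl

theorem eqs_iff (S : Finset Var) (a b : Var → Term) :
    w (eqs S a b) ↔ ∀ v ∈ S, w (.eq (a v) (b v)) := by
  have key : ∀ l : List Var, w ((l.map fun v => Formula.eq (a v) (b v)).foldr Formula.and tt) ↔
      ∀ v ∈ l, w (.eq (a v) (b v)) := by
    intro l
    induction l with
    | nil => simp [w.tt_holds]
    | cons x l ih => simp [and_iff, ih]
  simp [eqs, key]

/-! ### Quantifiers -/

theorem of_all {x : Var} {φ : Formula} (h : w (.all x φ)) : w φ := by
  refine w.of_proves_one (.allL (ψ := φ) ?_ .id) h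
  have := IsInstance.var (x := x) (φ := φ) x (by simp [Formula.fv])
  rwa [Equiv.swap_self, Formula.rename_refl] at this

theorem ex_of {x : Var} {φ : Formula} (h : w φ) : w (.ex x φ) := by
  refine w.of_proves_one (.exR (ψ := φ) ?_ .id) h
  have := IsInstance.var (x := x) (φ := φ) x (by simp [Formula.fv])
  rwa [Equiv.swap_self, Formula.rename_refl] at this

/-- The eigenvariable condition speaks about assumptions, and a world is an infinite set of them. So
whatever is needed of `w` is collected in one formula `γ` without the fresh variable, and the
premise ranges over all worlds satisfying `γ`. -/
theorem all_of {γ : Formula} {x y : Var} {φ : Formula} (hx : y ∉ γ.fv) (hy : y ∉ (all x φ).fv)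
    (h : ∀ w : World, w γ → w (φ.rename (Equiv.swap x y))) (hw : w γ) : w (.all x φ) :=
  w.of_proves_one (.allR y (by simpa using ⟨hy, hx⟩) (proves_one h)) hw

theorem all_of_self {γ : Formula} {x : Var} {φ : Formula} (hx : x ∉ γ.fv)
    (h : ∀ w : World, w γ → w φ) (hw : w γ) : w (.all x φ) :=
  w.all_of hx (by simp [Formula.fv])
    (by rwa [Equiv.swap_self, Formula.rename_refl]) hw

theorem of_ex {x : Var} {φ θ : Formula} (hx : x ∉ θ.fv) (h : ∀ w : World, w φ → w θ)
    (hw : w (.ex x φ)) : w θ := by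
  refine w.of_proves_one (.exL x (by simpa [Formula.fv] using hx) ?_) hw
  rw [Equiv.swap_self, Formula.rename_refl]
  exact proves_one h

theorem of_allVec {S : Finset Var} {σ : Equiv.Perm Var} {φ : Formula}
    (h : w (allVec S σ φ)) : w φ := by
  have key : ∀ l : List Var, w (l.foldr all φ) → w φ := by
    intro l
    induction l with
    | nil => exact id
    | cons x l ih => exact fun h => ih (w.of_all h)
  exact key _ h

theorem allVec_of {γ : Formula} {S : Finset Var} {σ : Equiv.Perm Var} {φ : Formula}
    (hS : ∀ v ∈ S, σ v ∉ γ.fv) (h : ∀ w : World, w γ → w φ) (hw : w γ) : w (allVec S σ φ) := by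
  have key : ∀ l : List Var, (∀ x ∈ l, x ∉ γ.fv) → ∀ w : World, w γ → w (l.foldr all φ) := by
    intro l
    induction l with
    | nil => exact fun _ => h
    | cons x l ih =>
      intro hl w
      exact w.all_of_self (hl x List.mem_cons_self)
        (ih fun y hy => hl y (List.mem_cons_of_mem _ hy))
  exact key _ (by simpa using hS) w hw

/-- Fresh variables can be assumed to name the values of given variables. -/
theorem of_fresh {v d : Var} {θ : Formula} (hd : d ∉ θ.fv) (hv : d ≠ v)
    (h : ∀ w : World, w (.eq (tv v) (tv d)) → w θ) : w θ := by
  refine w.of_ex hd h (w.fol trivial fun ω => ⟨ω v, ?_⟩)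
  simp [Formula.eq, Sat, Cmp.rel, val, Function.update_of_ne hv.symm]

theorem of_fresh_vec {S : Finset Var} {σ : Equiv.Perm Var} {θ : Formula}
    (hd : ∀ v ∈ S, σ v ∉ S ∪ θ.fv)
    (h : ∀ w : World, w (eqs S tv fun v => tv (σ v)) → w θ) : w θ := by
  have key : ∀ l : List Var, l.Nodup → ∀ θ : Formula, (∀ v ∈ l, σ v ∉ l.toFinset ∪ θ.fv) →
      (∀ w : World, (∀ v ∈ l, w (.eq (tv v) (tv (σ v)))) → w θ) → ∀ w : World, w θ := by
    intro l
    induction l with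
    | nil => exact fun _ θ _ h w => h w (by simp)
    | cons x l ih =>
      intro hl θ hσ h w
      simp only [List.mem_cons, List.toFinset_cons, Finset.mem_union, Finset.mem_insert,
        List.mem_toFinset, not_or, forall_eq_or_imp, List.nodup_cons] at hσ hl h
      refine w.of_fresh (v := x) (d := σ x) hσ.1.2 hσ.1.1.1 fun w hx => ?_
      -- Naming further values changes the world; the equation already obtained survives as a
      -- hypothesis inside the goal formula.
      refine w.imp_iff.1 (ih hl.2 (.imp (.eq (tv x) (tv (σ x))) θ) (fun v hv => ?_)
        (fun w hw => w.imp_iff.2 fun hx => h w ⟨hx, hw⟩) w) hx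
      have hne : v ≠ x := fun e => hl.1 (e ▸ hv)
      simp [Formula.imp, Formula.eq, Formula.fv, hσ.2 v hv, hne]
  refine key S.toList S.nodup_toList θ (by simpa using hd)
    (fun w hw => h w ((w.eqs_iff _ _ _).2 (by simpa using hw))) w

end World

/-! ### Canonical accessibility -/

/-- The accessibility relation between worlds that belongs to the modality `[α & Q]`. -/
def Acc (α : ODE) (Q : Formula) (w u : World) : Prop :=
  ∀ ψ : Formula, w (.box α Q ψ) → u ψ

namespace World

variable (w : World)

theorem box_imp {α : ODE} {Q φ ψ : Formula} (h : w (.box α Q (.imp φ ψ))) (hφ : w (.box α Q φ)) :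
    w (.box α Q ψ) :=
  w.imp_iff.1 (w.imp_iff.1 (w.of_ax (.kripke α Q φ ψ)) h) hφ

theorem box_of_forall {α : ODE} {Q φ : Formula} (h : ∀ u : World, u φ) : w (.box α Q φ) :=
  w.of_proves (.gen (derivable_of_worlds h))

theorem box_of_domain {α : ODE} {Q φ : Formula} (h : ∀ u : World, u Q → u φ) : w (.box α Q φ) :=
  w.of_proves (.dW (proves_one h))

/-- By generalization and the Kripke axiom, the formulas boxed in `w` are closed under derivability.
If `[α & Q]φ` is missing from `w`, these formulas therefore do not prove `φ`, and some world
contains all of them but not `φ`. -/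
theorem box_iff {α : ODE} {Q φ : Formula} :
    w (.box α Q φ) ↔ ∀ u, Acc α Q w u → u φ := by
  refine ⟨fun h u hu => hu φ h, fun h => ?_⟩
  by_contra hφ
  have key : ∀ (Γ : List Formula) (ψ : Formula), (∀ γ ∈ Γ, w (.box α Q γ)) → Proves Γ [ψ] →
      w (.box α Q ψ) := by
    intro Γ
    induction Γ with
    | nil => exact fun ψ _ hp => w.box_of_forall fun u => u.of_proves hp
    | cons γ Γ ih =>
      intro ψ hΓ hp
      exact w.box_imp (ih (.imp γ ψ) (fun δ hδ => hΓ δ (List.mem_cons_of_mem _ hδ)) (.impR hp))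
        (hΓ γ List.mem_cons_self)
  obtain ⟨u, hu, hnu⟩ := exists_world (G := {γ | w (.box α Q γ)}) (Δ := [φ])
    fun Γ hΓ hp => hφ (key Γ φ hΓ hp)
  exact hnu φ (by simp) (h u hu)

theorem dia_iff_not_box {α : ODE} {Q φ : Formula} :
    w (.dia α Q φ) ↔ ¬ w (.box α Q (.not φ)) := by
  rw [← not_iff]
  exact w.iff_iff.1 (w.of_ax (.diamond α Q φ))

theorem dia_iff {α : ODE} {Q φ : Formula} : w (.dia α Q φ) ↔ ∃ u, Acc α Q w u ∧ u φ := by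
  rw [dia_iff_not_box, box_iff]
  simp only [not_iff]
  push Not
  rfl

end World

namespace Acc

variable {α : ODE} {Q Q' Q₁ Q₂ φ χ : Formula} {w u : World}

theorem domain (h : Acc α Q w u) : u Q := h Q (w.box_of_domain fun _ => id)

theorem refl (h : w Q) : Acc α Q w w := fun ψ hψ =>
  (w.and_iff.1 (w.imp_iff.1 ((w.iff_iff.1 (w.of_ax (.skip α Q ψ))).1 hψ) h)).1

theorem const (h : Acc α Q w u) (hφ : Disjoint φ.fv α.vars) : w φ ↔ u φ := by
  have key : ∀ ψ : Formula, Disjoint ψ.fv α.vars → w ψ → u ψ := fun ψ hψ hw =>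
    h ψ (w.imp_iff.1 (w.of_ax (.vacuous α Q ψ hψ)) hw)
  refine ⟨key φ hφ, fun hu => ?_⟩
  by_contra hw
  exact u.not_iff.1 (key (.not φ) hφ (w.not_iff.2 hw)) hu

theorem cut (h : Acc α Q w u) (hχ : w (.box α Q χ)) : Acc α (.and Q χ) w u := by
  intro ψ hψ
  refine h ψ ?_
  have : Proves [.box α Q χ, .box α (.and Q χ) ψ] [.box α Q ψ] :=
    .dC .id (.structural (by simp) (List.Subset.refl _) (Proves.id (Γ := []) (Δ := [])))
  simpa using w.closed this (by simpa using ⟨hχ, hψ⟩)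

/-- The uniqueness axiom concerns a single postcondition. It lifts to pairs of worlds because
accessibility can be read through diamonds: everything true at `u` is possible at `w`. -/
theorem and_iff : Acc α (.and Q₁ Q₂) w u ↔ Acc α Q₁ w u ∧ Acc α Q₂ w u := by
  have key : ∀ φ : Formula, w (.dia α Q₁ φ) ∧ w (.dia α Q₂ φ) ↔ w (.dia α (.and Q₁ Q₂) φ) := by
    intro φ
    rw [← w.and_iff]
    exact w.iff_iff.1 (w.of_ax (.uniq α Q₁ Q₂ φ))
  have acc_iff : ∀ Q : Formula, Acc α Q w u ↔ ∀ φ, u φ → w (.dia α Q φ) := by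
    intro Q
    refine ⟨fun h φ hφ => w.dia_iff.2 ⟨u, h, hφ⟩, fun h ψ hψ => ?_⟩
    by_contra hu
    obtain ⟨v, hv, hvψ⟩ := w.dia_iff.1 (h _ (u.not_iff.2 hu))
    exact v.not_iff.1 hvψ (hv ψ hψ)
  simp only [acc_iff, ← key]
  exact ⟨fun h => ⟨fun φ hφ => (h φ hφ).1, fun φ hφ => (h φ hφ).2⟩,
    fun h φ hφ => ⟨h.1 φ hφ, h.2 φ hφ⟩⟩

/-- The semantic form of differential cut: `Q'` need not follow from `Q`, it only has to hold
wherever runs from `w` lead. -/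
theorem of_reachable (h : Acc α Q w u) (hQ : ∀ v, Acc α Q w v → v Q') : Acc α Q' w u :=
  (and_iff.1 (h.cut (w.box_iff.2 hQ))).2

theorem mono (h : Acc α Q w u) (hQ : ∀ v : World, v Q → v Q') : Acc α Q' w u :=
  h.of_reachable fun v hv => hQ v hv.domain

theorem to_tt (h : Acc α Q w u) : Acc α tt w u := h.mono fun v _ => v.tt_holds

end Acc

/-- Uniqueness of solutions for diamonds with the same postcondition. -/
theorem World.dia_and (w : World) {α : ODE} {Q₁ Q₂ φ : Formula} (h₁ : w (.dia α Q₁ φ))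
    (h₂ : w (.dia α Q₂ φ)) : w (.dia α (.and Q₁ Q₂) φ) :=
  (w.iff_iff.1 (w.of_ax (.uniq α Q₁ Q₂ φ))).1 (w.and_iff.2 ⟨h₁, h₂⟩)

theorem World.dia_mono (w : World) {α : ODE} {Q Q' φ ψ : Formula} (h : w (.dia α Q φ))
    (hQ : ∀ v : World, v Q → v Q') (hφ : ∀ v : World, v Q → v φ → v ψ) : w (.dia α Q' ψ) := by
  obtain ⟨u, hu, huφ⟩ := w.dia_iff.1 h
  exact w.dia_iff.2 ⟨u, hu.mono hQ, hφ u hu.domain huφ⟩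

/-! ### Fresh copies of vectors of variables -/

/-- `σ` maps the variables in `S` to a fresh copy (with respect to `V`), and equality of `S` with
its copy is a congruence for renaming along `σ`. -/
structure IsCopy (σ : Equiv.Perm Var) (S V : Finset Var) : Prop where
  fresh : FreshCopy σ S V
  rename_of : ∀ (w : World) (φ : Formula), (∀ v ∈ S, w (.eq (tv v) (tv (σ v)))) → w φ →
    w (φ.rename σ)

/-- The equation between `S` and its copy. -/
noncomputable abbrev atCopy (σ : Equiv.Perm Var) (S : Finset Var) : Formula :=
  eqs S tv fun v => tv (σ v)

theorem exists_isCopy (S V : Finset Var) : ∃ σ, IsCopy σ S V := by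
  -- `N` exceeds every variable in use, so the shifted variables `v + N` are fresh and distinct.
  obtain ⟨N, hN⟩ : ∃ N : ℕ, ∀ v : ℕ, v ∈ S ∪ V → v < N :=
    ⟨(S ∪ V).sup id + 1, fun v hv => Nat.lt_succ_of_le (Finset.le_sup (f := id) hv)⟩
  have key : ∀ l : List ℕ, l.Nodup → (∀ v ∈ l, v < N) → ∃ σ : Equiv.Perm ℕ,
      (∀ v ∈ l, σ v = v + N) ∧ (∀ v < N, v ∉ l → σ v = v) ∧
      ∀ (w : World) (φ : Formula), (∀ v ∈ l, w (.eq (tv v) (tv (v + N)))) → w φ →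
        w (φ.rename σ) := by
    intro l
    induction l with
    | nil =>
      exact fun _ _ => ⟨Equiv.refl _, by simp, by simp, fun w φ _ hw => by rwa [rename_refl]⟩
    | cons x l ih =>
      intro hl hlN
      simp only [List.nodup_cons, List.mem_cons, forall_eq_or_imp] at hl hlN
      obtain ⟨σ, h₁, h₂, h₃⟩ := ih hl.2 hlN.2
      -- The copy is built by transpositions because the equality rule interchanges one pair of
      -- variables at a time.
      refine ⟨Equiv.swap x (x + N) * σ, ?_, ?_, ?_⟩
      · intro v hv
        rw [Equiv.Perm.mul_apply]
        rcases List.mem_cons.1 hv with rfl | hv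
        · rw [h₂ v hlN.1 hl.1, Equiv.swap_apply_left]
        · have hne : v ≠ x := fun e => hl.1 (e ▸ hv)
          have hlt := hlN.1
          rw [h₁ v hv, Equiv.swap_apply_of_ne_of_ne] <;> omega
      · intro v hv hvl
        simp only [List.mem_cons, not_or] at hvl
        rw [Equiv.Perm.mul_apply, h₂ v hv hvl.2, Equiv.swap_apply_of_ne_of_ne hvl.1 (by omega)]
      · intro w φ hw hφ
        simp only [List.mem_cons, forall_eq_or_imp] at hw
        rw [← rename_rename]
        have := w.closed (.eqRename x (x + N) (φ.rename σ))
          (by simpa using ⟨hw.1, h₃ w φ hw.2 hφ⟩)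
        simpa using this
  obtain ⟨σ, h₁, h₂, h₃⟩ := key S.toList S.nodup_toList
    (fun v hv => hN v (Finset.mem_union_left _ (by simpa using hv)))
  simp only [Finset.mem_toList] at h₁ h₂ h₃
  refine ⟨σ, ⟨fun v hv hσ => ?_, fun v hv => ?_⟩, fun w φ hw => h₃ w φ fun v hv => ?_⟩
  · rw [h₁ v hv] at hσ
    exact absurd (hN _ hσ) (Nat.not_lt.2 (Nat.le_add_left _ _))
  · rw [Finset.mem_sdiff] at hv
    exact h₂ v (hN v (Finset.mem_union_right _ hv.1)) hv.2
  · rw [← h₁ v hv]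
    exact hw v hv

theorem FreshCopy.mono {σ : Equiv.Perm Var} {S V V' : Finset Var} (h : FreshCopy σ S V)
    (hV : V' ⊆ V) : FreshCopy σ S V' :=
  ⟨fun v hv hσ => h.1 v hv (Finset.union_subset_union_right hV hσ),
    fun v hv => h.2 v (Finset.sdiff_subset_sdiff hV (Finset.Subset.refl _) hv)⟩

namespace IsCopy

variable {σ : Equiv.Perm Var} {S V : Finset Var}

theorem mono {V' : Finset Var} (h : IsCopy σ S V) (hV : V' ⊆ V) : IsCopy σ S V' :=
  ⟨h.fresh.mono hV, h.rename_of⟩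

theorem notMem (h : IsCopy σ S V) {v : Var} (hv : v ∈ S) : σ v ∉ V := fun hσ =>
  h.fresh.1 v hv (Finset.mem_union_right _ hσ)

theorem rename_iff (h : IsCopy σ S V) {w : World} {φ : Formula} (hw : w (atCopy σ S)) :
    w (φ.rename σ) ↔ w φ := by
  have hw' := (w.eqs_iff _ _ _).1 hw
  refine ⟨fun hφ => ?_, h.rename_of w φ hw'⟩
  by_contra hn
  exact w.not_iff.1 (h.rename_of w (.not φ) hw' (w.not_iff.2 hn)) hφ

theorem disjoint_rename (h : IsCopy σ S V) {φ : Formula} (hφ : φ.fv ⊆ V) :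
    Disjoint (φ.rename σ).fv S := by
  rw [Finset.disjoint_left]
  intro u hu huS
  obtain ⟨v, hv, rfl⟩ := Finset.mem_image.1 (fv_rename σ φ hu)
  by_cases hvS : v ∈ S
  · exact h.fresh.1 v hvS (Finset.mem_union_left _ huS)
  · rw [h.fresh.2 v (Finset.mem_sdiff.2 ⟨hφ hv, hvS⟩)] at huS
    exact hvS huS

/-- Formulas at a world that agrees with the copy can be read off in any earlier world. -/
theorem iff_rename (h : IsCopy σ S V) {α : ODE} {Q φ : Formula} {w u : World} (hα : α.vars = S)
    (hφ : φ.fv ⊆ V) (hwu : Acc α Q w u) (hu : u (atCopy σ S)) : u φ ↔ w (φ.rename σ) := by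
  rw [← h.rename_iff hu]
  exact (hwu.const (hα ▸ h.disjoint_rename hφ)).symm

end IsCopy

/-! ### Reversal -/

/-- By the Barcan axiom, the value of `v` at the end of a run can be named by a fresh `d` already at
its start. The worlds change in the process, so only what is recorded in `φ` and `θ` is kept. -/
theorem Acc.of_witness {α : ODE} {Q φ θ : Formula} {v d : Var} (hα : d ∉ α.fv) (hQ : d ∉ Q.fv)
    (hφ : d ∉ φ.fv) (hθ : d ∉ θ.fv) (hv : d ≠ v)
    (h : ∀ w u : World, Acc α Q w u → u φ → u (.eq (tv v) (tv d)) → w θ)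
    {w u : World} (hwu : Acc α Q w u) (hu : u φ) : w θ := by
  refine w.of_ex hθ (φ := .dia α Q (.and φ (.eq (tv v) (tv d)))) (fun w hw => ?_) ?_
  · obtain ⟨u, hu, huφ⟩ := w.dia_iff.1 hw
    rw [u.and_iff] at huφ
    exact h w u hu huφ.1 huφ.2
  · refine (w.iff_iff.1 (w.of_ax (.barcan α Q _ d (by simp [hα, hQ])))).1
      (w.dia_iff.2 ⟨u, hwu, ?_⟩)
    refine u.imp_iff.1 (u.of_fresh (v := v) (d := d)
      (θ := .imp φ (.ex d (.and φ (.eq (tv v) (tv d))))) ?_ hv fun u hd => ?_) hu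
    · simp [Formula.imp, Formula.fv, hφ]
    · exact u.imp_iff.2 fun huφ => u.ex_of (u.and_iff.2 ⟨huφ, hd⟩)

theorem Acc.of_witness_vec {α : ODE} {Q φ θ : Formula} {S V : Finset Var} {σ : Equiv.Perm Var}
    (hσ : FreshCopy σ S V) (hα : α.fv ⊆ V) (hQ : Q.fv ⊆ V) (hφ : φ.fv ⊆ V) (hθ : θ.fv ⊆ V)
    (h : ∀ w u : World, Acc α Q w u → u φ → u (atCopy σ S) → w θ)
    {w u : World} (hwu : Acc α Q w u) (hu : u φ) : w θ := by
  have key : ∀ l : List Var, l.Nodup → (∀ v ∈ l, v ∈ S) → ∀ φ : Formula,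
      (∀ v ∈ l, σ v ∉ φ.fv) → (∀ w u : World, Acc α Q w u → u φ →
        (∀ v ∈ l, u (.eq (tv v) (tv (σ v)))) → w θ) →
      ∀ w u : World, Acc α Q w u → u φ → w θ := by
    intro l
    induction l with
    | nil => exact fun _ _ φ _ h w u hwu hu => h w u hwu hu (by simp)
    | cons x l ih =>
      intro hl hlS φ hφ h w u hwu hu
      simp only [List.nodup_cons, List.mem_cons, forall_eq_or_imp] at hl hlS hφ h
      have hx := hσ.1 x hlS.1
      simp only [Finset.mem_union, not_or] at hx
      refine Acc.of_witness (v := x) (d := σ x) (fun hd => hx.2 (hα hd)) (fun hd => hx.2 (hQ hd))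
        hφ.1 (fun hd => hx.2 (hθ hd)) (fun e => hx.1 (e.symm ▸ hlS.1)) (fun w u hwu hu hd => ?_)
        hwu hu
      refine ih hl.2 hlS.2 (.and φ (.eq (tv x) (tv (σ x)))) (fun v hv => ?_)
        (fun w u hwu hu hd => ?_) w u hwu (u.and_iff.2 ⟨hu, hd⟩)
      · have hne : v ≠ x := fun e => hl.1 (e ▸ hv)
        have hnx : σ v ≠ x := fun e =>
          hσ.1 v (hlS.2 v hv) (Finset.mem_union_left _ (e ▸ hlS.1))
        simp [Formula.eq, Formula.fv, hφ.2 v hv, hne, hnx]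
      · rw [u.and_iff] at hu
        exact h w u hwu hu.1 ⟨hu.2, hd⟩
  refine key S.toList S.nodup_toList (by simp) φ (fun v hv hd => ?_)
    (fun w u hwu hu hd => h w u hwu hu ((u.eqs_iff _ _ _).2 (by simpa using hd))) w u hwu hu
  exact hσ.1 v (by simpa using hv) (Finset.mem_union_right _ (hφ hd))

/-- Let `y` name the values of `x` at `u`. A box of the reversed system true at `u` holds there for
`y` too; this version is constant along `α`, so it holds at `w`. The adjoint axiom then runs `y`
backwards from `w` until `y = x`, where the postcondition for `y` becomes the one for `x`. -/
theorem Acc.neg {α : ODE} {Q : Formula} {w u : World} (h : Acc α Q w u) : Acc α.neg Q u w := by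
  intro ψ hψ
  obtain ⟨σ, hσ⟩ := exists_isCopy α.vars (α.fv ∪ Q.fv ∪ ψ.fv)
  have hαV : α.fv ⊆ α.fv ∪ Q.fv ∪ ψ.fv := fun v hv => by simp [hv]
  have hQV : Q.fv ⊆ α.fv ∪ Q.fv ∪ ψ.fv := fun v hv => by simp [hv]
  have hψV : ψ.fv ⊆ α.fv ∪ Q.fv ∪ ψ.fv := fun v hv => by simp [hv]
  refine Acc.of_witness_vec hσ.fresh hαV hQV (φ := .box α.neg Q ψ) ?_ hψV
    (fun w u hwu hu hd => ?_) h hψ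
  · simp [Formula.fv, ODE.fv_neg]
  have hr : w (.box (α.neg.rename σ) (Q.rename σ) (ψ.rename σ)) := by
    refine (hwu.const (φ := (Formula.box α.neg Q ψ).rename σ)
      (hσ.disjoint_rename (by simp [Formula.fv, ODE.fv_neg]))).2 ?_
    exact (hσ.rename_iff hd).2 hu
  have hadj := (w.iff_iff.1 (w.of_ax (.adjoint α Q σ
    (hσ.fresh.mono Finset.subset_union_left)))).1 (w.dia_iff.2 ⟨u, hwu, hd⟩)
  obtain ⟨v, hwv, hv⟩ := w.dia_iff.1 hadj
  have hvψ : v ψ := by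
    refine (hσ.rename_iff ?_).1 (hwv _ hr)
    refine v.fol₁ (fun ω => ?_) hv
    simp only [sat_eqs]
    exact fun h v hv => (h v hv).symm
  -- The renamed system moves only the copy variables, none of which is free in `ψ`.
  refine (hwv.const ?_).2 hvψ
  rw [Finset.disjoint_left]
  intro a ha hv
  simp only [ODE.rename, ODE.neg, Finset.mem_map_equiv] at hv
  have := hσ.notMem hv
  simp only [Equiv.apply_symm_apply] at this
  exact this (hψV ha)

theorem Acc.of_neg {α : ODE} {Q : Formula} {w u : World} (h : Acc α.neg Q u w) : Acc α Q w u := by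
  simpa [ODE.neg_neg] using h.neg

/-- Every world along a run still reaches the final world. -/
theorem Acc.remaining {α : ODE} {Q Q' : Formula} {w u : World} (h : Acc α Q w u)
    (hQ : ∀ v, Acc α Q v u → v Q') : Acc α (.and Q Q') w u :=
  (h.neg.cut (u.box_iff.2 fun v hv => hQ v hv.of_neg)).of_neg

theorem derivable_rev (α : ODE) (P Q : Formula) :
    Derivable (.imp P (.box α Q (.dia α.neg Q P))) :=
  derivable_of_worlds fun w => w.imp_iff.2 fun hP => w.box_iff.2 fun u hu =>
    u.dia_iff.2 ⟨w, hu.neg, hP⟩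

theorem derivable_idem (α : ODE) (P Q : Formula) :
    Derivable (.imp (.dia α Q P) (.dia α (.and Q (.dia α Q P)) P)) := by
  refine derivable_of_worlds fun w => w.imp_iff.2 fun h => ?_
  obtain ⟨u, hu, huP⟩ := w.dia_iff.1 h
  exact w.dia_iff.2 ⟨u, hu.remaining fun v hv => v.dia_iff.2 ⟨u, hv, huP⟩, huP⟩

/-! ### Clocks -/

/-- `c` is a clock of the system. -/
structure ODE.IsClock (α : ODE) (c : Var) : Prop where
  mem : c ∈ α.vars
  rhs_eq : α.rhs c = 1

namespace Acc

variable {α : ODE} {Q φ : Formula} {w u : World} {c : Var} {τ : Term}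

/-- `τ` is constant along the system, so `c - τ` has Lie derivative `1`. -/
theorem clock_ge (h : Acc α Q w u) (hc : α.IsClock c) (hτ : Disjoint τ.vars α.vars)
    (hw : w (.ge (tv c) τ)) : u (.ge (tv c) τ) := by
  have hp := w.imp_iff.1 (w.of_ax (.invGe α Q (tv c - τ))) (w.box_of_forall fun v =>
    v.fol trivial fun ω => by
      simp [ODE.lie_sub, ODE.lie_tv, ODE.lie_of_disjoint α τ hτ, hc.rhs_eq, Sat, Formula.ge,
        Cmp.rel, val])
  have hu := h _ ((w.iff_iff.1 hp).2 (w.imp_iff.2 fun _ => w.fol₁ (fun ω => by simp [Sat, Formula.ge, Cmp.rel, val]) hw))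
  exact u.fol₁ (fun ω => by simp [Sat, Formula.ge, Cmp.rel, val]) hu

theorem clock_gt (h : Acc α Q w u) (hc : α.IsClock c) (hτ : Disjoint τ.vars α.vars)
    (hw : w (.gt (tv c) τ)) : u (.gt (tv c) τ) := by
  have hp := w.imp_iff.1 (w.of_ax (.invGt α Q (tv c - τ))) (w.box_of_forall fun v =>
    v.fol trivial fun ω => by
      simp [ODE.lie_sub, ODE.lie_tv, ODE.lie_of_disjoint α τ hτ, hc.rhs_eq, Sat, Formula.ge,
        Cmp.rel, val])
  have hu := h _ ((w.iff_iff.1 hp).2 (w.imp_iff.2 fun _ => w.fol₁ (fun ω => by simp [Sat, Formula.gt, Cmp.rel, val]) hw))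
  exact u.fol₁ (fun ω => by simp [Sat, Formula.gt, Cmp.rel, val]) hu

theorem clock_le (h : Acc α Q w u) (hc : α.IsClock c) (hτ : Disjoint τ.vars α.vars)
    (hu : u (.le (tv c) τ)) : w (.le (tv c) τ) := by
  by_contra hw
  have hgt := h.clock_gt hc hτ (w.fol₁ (φ := .not (.le (tv c) τ)) (fun ω => by simp [Sat, Formula.le, Formula.gt, Cmp.rel]) (w.not_iff.2 hw))
  refine u.not_iff.1 (u.fol₁ (fun ω => ?_) hgt) hu
  simp [Sat, Formula.le, Formula.gt, Cmp.rel]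

/-- A system with a clock that is not allowed to advance does not move. -/
theorem of_stuck (h : Acc α (.le (tv c) τ) w u) (hc : α.IsClock c)
    (hτ : Disjoint τ.vars α.vars) (hw : w (.eq (tv c) τ)) (hφ : w φ) : u φ := by
  obtain ⟨σ, hσ⟩ := exists_isCopy α.vars
    (Formula.imp (.eq (tv c) τ) (.imp φ (.box α (.le (tv c) τ) φ))).fv
  refine h _ (w.imp_iff.1 (w.imp_iff.1 (w.of_fresh_vec hσ.fresh.1 fun w hcopy =>
    w.imp_iff.2 fun hw => w.imp_iff.2 fun hφ => w.box_iff.2 fun u h => ?_) hw) hφ)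
  -- The copy records the values at `w`. The renamed `φ` is constant along the run, so it remains to
  -- see that `u` agrees with the copy.
  refine (hσ.rename_iff ?_).1 ((h.const (hσ.disjoint_rename fun v hv => ?_)).1
    ((hσ.rename_iff hcopy).2 hφ))
  swap
  · simp [Formula.imp, Formula.fv, hv]
  have hge : w (.ge (tv c) τ) := w.fol₁ (fun ω => by simpa [Sat, Formula.eq, Formula.ge, Cmp.rel] using fun h => h.ge) hw
  have hstay : ∀ v, Acc α (.le (tv c) τ) w v → v (.eq (tv c) τ) := fun v hv =>
    v.fol₂ (fun ω => by simpa [Sat, Formula.eq, Formula.ge, Formula.le, Cmp.rel] using le_antisymm)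
      hv.domain (hv.clock_ge hc hτ hge)
  refine (u.eqs_iff _ _ _).2 fun x hx => ?_
  -- The correction `f_x · (c - τ)` cancels the drift `f_x` of `x`. What is left of the derivative
  -- has the factor `c - τ`, which is zero throughout since the clock is stuck. The term is zero at
  -- `w`, and at `u` its vanishing with `c = τ` means `x = σ x`.
  have hlie : α.lie (tv x - tv (σ x) - α.rhs x * (tv c - τ)) =
      -((tv c - τ) * α.lie (α.rhs x)) := by
    have hσx : α.rhs (σ x) = 0 :=
      α.rhs_off _ fun h => hσ.fresh.1 x hx (Finset.mem_union_left _ h)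
    rw [ODE.lie_sub, ODE.lie_sub, ODE.lie_mul, ODE.lie_sub, ODE.lie_tv α x, ODE.lie_tv α (σ x),
      ODE.lie_tv α c, hσx, ODE.lie_of_disjoint α τ hτ, hc.rhs_eq]
    ring
  have hp := w.imp_iff.1 (w.of_ax (.invEq α (.le (tv c) τ)
    (tv x - tv (σ x) - α.rhs x * (tv c - τ)))) (w.box_iff.2 fun v hv =>
      v.fol₁ (fun ω hω => by
        simp only [Sat, Formula.eq, Cmp.rel, hlie] at hω ⊢
        simp only [val, map_neg, map_mul, map_sub, map_zero] at hω ⊢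
        rw [hω]
        ring) (hstay v hv))
  have hu := h _ ((w.iff_iff.1 hp).2 (w.imp_iff.2 fun _ => w.fol₂ (fun ω h₁ h₂ => by
      simp only [Sat, Formula.eq, Cmp.rel] at h₁ h₂ ⊢
      simp only [val, map_mul, map_sub, map_zero] at h₁ h₂ ⊢
      rw [h₁, h₂]
      ring) hw ((w.eqs_iff _ _ _).1 hcopy x hx)))
  refine u.fol₂ (fun ω h₁ h₂ => ?_) (hstay u h) hu
  simp only [Sat, Formula.eq, Cmp.rel] at h₁ h₂ ⊢
  simp only [val, map_mul, map_sub, map_zero] at h₁ h₂ ⊢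
  rw [h₁] at h₂
  linarith

theorem stuck_iff (h : Acc α (.le (tv c) τ) w u) (hc : α.IsClock c)
    (hτ : Disjoint τ.vars α.vars) (hw : w (.eq (tv c) τ)) : w φ ↔ u φ := by
  refine ⟨h.of_stuck hc hτ hw, fun hu => ?_⟩
  by_contra hn
  exact u.not_iff.1 (h.of_stuck hc hτ hw (w.not_iff.2 hn)) hu

/-- Along a run to a world at time `τ`, the time is at most `τ`, and every world at time `τ`
agrees with the final one. -/
theorem until_clock (h : Acc α Q w u) (hc : α.IsClock c) (hτ : Disjoint τ.vars α.vars)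
    (hu : u (.eq (tv c) τ)) (hφ : u φ) :
    Acc α (.and (.and Q (.le (tv c) τ)) (.imp (.eq (tv c) τ) φ)) w u := by
  have hle : u (.le (tv c) τ) := u.fol₁ (fun ω => by simpa [Sat, Formula.eq, Formula.le, Cmp.rel] using fun h => h.le) hu
  -- The rest of the run from `v` to `u` keeps `c ≤ τ`, so if `v` is already at time `τ` it is
  -- stuck.
  refine (h.remaining fun v hv => hv.clock_le hc hτ hle).remaining fun v hv =>
    v.imp_iff.2 fun hvc => ((and_iff.1 hv).2.stuck_iff hc hτ hvc).2 hφ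

end Acc

theorem ODE.isClock_withClock {α : ODE} {t : Var} (ht : t ∉ α.vars) :
    (α.withClock t).IsClock t := by
  constructor
  · simp [ODE.withClock, ODE.join, ODE.single]
  · simp [ODE.withClock, ODE.join, ODE.single, α.rhs_off t ht]

theorem derivable_stuck (α : ODE) (t : Var) (t₀ : Term) (P : Formula) (ht : t ∉ α.vars)
    (ht₀ : Disjoint t₀.vars (α.withClock t).vars) :
    Derivable (.imp (.eq (tv t) t₀)
      (.iff (.box (α.withClock t) (.le (tv t) t₀) P) P)) := by
  refine derivable_of_worlds fun w => w.imp_iff.2 fun h => w.iff_iff.2 ⟨fun hbox => ?_, fun hP =>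
    w.box_iff.2 fun u hu => hu.of_stuck (ODE.isClock_withClock ht) ht₀ h hP⟩
  refine Acc.refl ?_ _ hbox
  exact w.fol₁ (fun ω => by simpa [Sat, Formula.eq, Formula.le, Cmp.rel] using fun h => h.le) h

/-! ### There and back -/

/-- All worlds in the past from time `t₀` on satisfy `χ`. -/
noncomputable abbrev past (α : ODE) (c t₀ : Var) (χ : Formula) : Formula :=
  .box α.neg tt (.imp (.ge (tv c) (tv t₀)) χ)

theorem fv_past_subset {α : ODE} {c t₀ : Var} (hc : c ∈ α.vars) (χ : Formula) :
    (past α c t₀ χ).fv ⊆ insert t₀ (α.fv ∪ χ.fv) := by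
  intro v hv
  have hcα : c ∈ α.fv := Finset.mem_union_left _ hc
  simp only [Formula.fv, ODE.fv_neg, Formula.imp, Formula.ge, tt, Formula.eq,
    MvPolynomial.vars_X, MvPolynomial.vars_0, Finset.mem_union, Finset.mem_singleton,
    Finset.notMem_empty] at hv
  simp only [Finset.mem_insert, Finset.mem_union]
  grind

theorem disjoint_vars_tv {α : ODE} {t : Var} (ht : t ∉ α.fv) :
    Disjoint (tv t).vars α.vars := by
  simpa [MvPolynomial.vars_X] using fun h => ht (Finset.mem_union_left _ h)

theorem past_congr {α : ODE} {c t₀ t₁ : Var} {χ : Formula} {w : World} (h₀ : t₀ ∉ α.fv)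
    (h₁ : t₁ ∉ α.fv) (h : w (.eq (tv t₀) (tv t₁))) (hw : w (past α c t₀ χ)) :
    w (past α c t₁ χ) := by
  refine w.box_iff.2 fun u hu => u.imp_iff.2 fun hc => ?_
  refine u.imp_iff.1 (hu _ hw) (u.fol₂ (fun ω h₁ h₂ => ?_) hc
    ((hu.const ?_).1 h))
  · simp only [Sat, Formula.eq, Formula.ge, Cmp.rel] at h₁ h₂ ⊢
    rwa [h₂]
  · have h₀' : t₀ ∉ α.neg.vars := fun h => h₀ (Finset.mem_union_left _ h)
    have h₁' : t₁ ∉ α.neg.vars := fun h => h₁ (Finset.mem_union_left _ h)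
    simp [Formula.eq, Formula.fv, MvPolynomial.vars_X, h₀', h₁']

/-- Unlike in the there-and-back axiom, `φ` may mention `t₀`; this is what allows arbitrary formulas
in `Acc.iff_past`. The axiom is applied with a fresh `t₁`, and `t₁ = t₀` is constant along the runs.
-/
theorem box_iff_box_past {α : ODE} {c t₀ : Var} {χ φ : Formula} {w : World} (hc : α.IsClock c)
    (ht : t₀ ∉ α.fv ∪ χ.fv) (hw : w (.eq (tv c) (tv t₀))) :
    w (.box α χ φ) ↔ w (.box α tt (.imp (past α c t₀ χ) φ)) := by
  obtain ⟨t₁, ht₁⟩ := Infinite.exists_notMem_finset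
    (insert t₀ (insert c (α.fv ∪ χ.fv ∪ φ.fv)))
  simp only [Finset.mem_insert, Finset.mem_union, not_or] at ht₁ ht
  obtain ⟨h10, h1c, ⟨h1α, h1χ⟩, h1φ⟩ := ht₁
  have hcα : c ∈ α.fv := Finset.mem_union_left _ hc.mem
  have key := w.of_fresh (v := c) (d := t₁) (θ := .imp (.eq (tv c) (tv t₀))
    (.iff (.box α χ φ) (.box α tt (.imp (past α c t₀ χ) φ)))) (fun hd => by
      have := @fv_past_subset α c t₀ hc.mem χ t₁
      simp only [past, Formula.fv, ODE.fv_neg, Formula.imp, Formula.iff, Formula.ge, tt,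
        Formula.eq, MvPolynomial.vars_X, MvPolynomial.vars_0, Finset.mem_union,
        Finset.mem_singleton, Finset.notMem_empty] at hd
      grind) h1c fun w hw₁ => ?_
  · exact w.iff_iff.1 (w.imp_iff.1 key hw)
  refine w.imp_iff.2 fun hw => w.iff_iff.2 ?_
  have hax := w.iff_iff.1 (w.of_ax (.thereAndBack α χ φ c t₁ hc.mem hc.rhs_eq
    (by simp [h1α, h1χ, h1φ])))
  have hsymm : ∀ s : Var, w (.eq (tv c) (tv s)) → w (.eq (tv s) (tv c)) := fun s h =>
    w.fol₁ (fun ω => by simpa [Sat, Formula.eq, Cmp.rel] using Eq.symm) h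
  have h01 : w (.eq (tv t₀) (tv t₁)) := w.fol₂ (fun ω h₁ h₂ => by
    simp only [Sat, Formula.eq, Cmp.rel] at h₁ h₂ ⊢
    rw [← h₁, h₂]) hw hw₁
  have hdisj : ∀ s r : Var, s ∉ α.fv → r ∉ α.fv →
      Disjoint (Formula.eq (tv s) (tv r)).fv α.vars := by
    intro s r hs hr
    simp only [Formula.eq, Formula.fv, Finset.disjoint_union_left]
    exact ⟨disjoint_vars_tv hs, disjoint_vars_tv hr⟩
  have h10' : w (.eq (tv t₁) (tv t₀)) :=
    w.fol₁ (fun ω => by simpa [Sat, Formula.eq, Cmp.rel] using Eq.symm) h01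
  have hswitch : w (.box α tt (.imp (past α c t₀ χ) φ)) ↔
      w (.box α tt (.imp (past α c t₁ χ) φ)) := by
    simp only [w.box_iff, World.imp_iff]
    refine forall₂_congr fun u hu => imp_congr_left ⟨past_congr ht.1 h1α ?_,
      past_congr h1α ht.1 ?_⟩
    · exact (hu.const (hdisj _ _ ht.1 h1α)).1 h01
    · exact (hu.const (hdisj _ _ h1α ht.1)).1 h10'
  rw [hswitch, hax]
  constructor
  · exact fun h => w.imp_iff.1 (w.of_all h) (hsymm _ hw₁)
  · intro h
    -- Any other instance `t₂` of the bound variable that equals `c` also equals `t₁`, so the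
    -- equality rule transports the statement from `t₁` to `t₂`.
    obtain ⟨t₂, ht₂⟩ := Infinite.exists_notMem_finset
      ((Formula.all t₁ (.imp (.eq (tv t₁) (tv c)) (.box α tt (.imp (past α c t₁ χ) φ)))).fv ∪
        (Formula.and (.eq (tv t₁) (tv c)) (.box α tt (.imp (past α c t₁ χ) φ))).fv)
    rw [Finset.mem_union, not_or] at ht₂
    refine w.all_of ht₂.2 ht₂.1 (fun w hw => ?_) (w.and_iff.2 ⟨hsymm _ hw₁, h⟩)
    rw [w.and_iff] at hw
    refine w.imp_iff.2 fun hc₂ => ?_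
    have hcne : Equiv.swap t₁ t₂ c = c := by
      refine Equiv.swap_apply_of_ne_of_ne (Ne.symm h1c) fun e => ht₂.2 ?_
      simp [Formula.fv, Formula.eq, MvPolynomial.vars_X, e]
    have h12 : w (.eq (tv t₁) (tv t₂)) := by
      refine w.fol₂ (fun ω h₁ h₂ => ?_) hw.1 hc₂
      simp only [Sat, Formula.eq, Formula.rename, Cmp.rel, MvPolynomial.rename_X, hcne,
        Equiv.swap_apply_left] at h₁ h₂ ⊢
      rw [h₁, h₂]
    simpa using w.closed (.eqRename t₁ t₂ _) (by simpa using ⟨h12, hw.2⟩)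

/-- A constraint on a whole run becomes a property of its endpoint alone. -/
theorem Acc.iff_past {α : ODE} {c t₀ : Var} {χ : Formula} {w u : World} (hc : α.IsClock c)
    (ht : t₀ ∉ α.fv ∪ χ.fv) (hw : w (.eq (tv c) (tv t₀))) :
    Acc α χ w u ↔ Acc α tt w u ∧ u (past α c t₀ χ) := by
  refine ⟨fun h => ⟨h.to_tt, h _ ((box_iff_box_past hc ht hw).2 ?_)⟩, fun h ψ hψ =>
    u.imp_iff.1 (h.1 _ ((box_iff_box_past hc ht hw).1 hψ)) h.2⟩
  exact w.box_of_forall fun u => u.imp_iff.2 id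

/-! ### Continuity and real induction -/

theorem World.dia_of_pos (w : World) {α : ODE} {σ : Equiv.Perm Var} {V : Finset Var} {e : Term}
    (hσ : FreshCopy σ α.vars V) (hα : α.fv ⊆ V) (he : e.vars ⊆ V)
    (hmove : ∃ c ∈ α.vars, ∀ ω, val ω (α.rhs c) ≠ 0) (hw : w (atCopy σ α.vars))
    (hpos : w (.gt e 0)) : w (.dia α (.gt e 0) (.not (atCopy σ α.vars))) := by
  refine (w.iff_iff.1 (w.imp_iff.1 (w.of_ax (.cont α e σ
    (hσ.mono (Finset.union_subset hα he)))) (w.and_iff.2 ⟨hw, w.fol (isFOL_eqs _ _ _) ?_⟩))).2 hpos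
  obtain ⟨c, hc, hne⟩ := hmove
  refine fun ω hω => hne ω ?_
  simpa [val] using (sat_eqs _ _ _ _).1 hω c hc

theorem ODE.IsClock.moves {α : ODE} {c : Var} (hc : α.IsClock c) :
    ∃ c ∈ α.vars, ∀ ω, val ω (α.rhs c) ≠ 0 :=
  ⟨c, hc.mem, fun ω => by simp [hc.rhs_eq, val]⟩

theorem ODE.IsClock.moves_neg {α : ODE} {c : Var} (hc : α.IsClock c) :
    ∃ c ∈ α.neg.vars, ∀ ω, val ω (α.neg.rhs c) ≠ 0 :=
  ⟨c, hc.mem, fun ω => by simp [ODE.neg, hc.rhs_eq, val]⟩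

section RealInduction

variable {α : ODE} {Q φ γ : Formula} {c : Var} {V : Finset Var}

theorem box_of_realInduction {σ : Equiv.Perm Var} (hc : α.IsClock c)
    (hσ : FreshCopy σ α.vars V) (hα : α.fv ⊆ V) (hφ : φ.fv ⊆ V) (hγ : γ.fv ⊆ V)
    (h : ∀ w : World, w γ → ∀ u, Acc α (.or φ (atCopy σ α.vars)) w u → u (atCopy σ α.vars) →
      u φ ∧ u (.dia α (.or φ (atCopy σ α.vars)) (.not (atCopy σ α.vars))))
    {w : World} (hw : w γ) : w (.box α tt φ) := by
  refine (w.iff_iff.1 (w.of_ax (.realInduction α φ σ ⟨c, hc.mem, hc.rhs_eq⟩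
    (hσ.mono (Finset.union_subset hα hφ))))).2 (w.allVec_of (γ := γ) (fun v hv hd =>
      hσ.1 v hv (Finset.mem_union_right _ (hγ hd))) (fun w hw => ?_) hw)
  exact w.box_iff.2 fun u hu => u.imp_iff.2 fun hcopy => u.and_iff.2 (h w hw u hu hcopy)

/-- Real induction in its converse direction: a formula true on all runs persists for a while beyond
each reached world. This serves for formulas that are not strict inequalities, where the continuity
axiom says nothing. -/
theorem Acc.progress {σ : Equiv.Perm Var} {w u : World} (hc : α.IsClock c)
    (hσ : FreshCopy σ α.vars V) (hα : α.fv ⊆ V) (hφ : φ.fv ⊆ V) (hbox : w (.box α tt φ))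
    (hu : Acc α tt w u) (hcopy : u (atCopy σ α.vars)) :
    u (.dia α (.or φ (atCopy σ α.vars)) (.not (atCopy σ α.vars))) := by
  have h := w.of_allVec ((w.iff_iff.1 (w.of_ax (.realInduction α φ σ ⟨c, hc.mem, hc.rhs_eq⟩
    (hσ.mono (Finset.union_subset hα hφ))))).1 hbox)
  refine (u.and_iff.1 (u.imp_iff.1 (hu.of_reachable (fun v hv => ?_) _ h) hcopy)).2
  exact v.or_iff.2 (Or.inl (hv _ hbox))

/-- Real induction with a domain constraint. -/
theorem box_of_realInduction_domain (hc : α.IsClock c) (hα : α.fv ⊆ V) (hQ : Q.fv ⊆ V)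
    (hφ : φ.fv ⊆ V) (hγ : γ.fv ⊆ V)
    (h : ∀ σ, IsCopy σ α.vars V → ∀ w : World, w γ → ∀ u,
      Acc α (.and Q (.or φ (atCopy σ α.vars))) w u → u (atCopy σ α.vars) →
      u φ ∧ u (.dia α (.or φ (atCopy σ α.vars)) (.not (atCopy σ α.vars))))
    {w : World} (hw : w γ) : w (.box α Q φ) := by
  obtain ⟨t₀, ht₀⟩ := Infinite.exists_notMem_finset V
  obtain ⟨t₁, ht₁⟩ := Infinite.exists_notMem_finset (insert t₀ V)
  have ht₁V : t₁ ∉ V := fun h => ht₁ (Finset.mem_insert_of_mem h)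
  have hcV : c ∈ V := hα (Finset.mem_union_left _ hc.mem)
  have hθ : ∀ t ∉ V, t ∉ (Formula.imp γ (.box α Q φ)).fv := by
    intro t ht hd
    simp only [Formula.imp, Formula.fv, Finset.mem_union] at hd
    grind
  refine w.imp_iff.1 (w.of_fresh (v := c) (hθ t₀ ht₀) (fun e => ht₀ (e ▸ hcV))
    fun w hw₀ => ?_) hw
  -- The formula `B` below contains `t₀`, so nesting it in another `past` needs a second name for
  -- the initial time.
  refine w.imp_iff.1 (w.of_fresh (v := c) (d := t₁) (θ := .imp (.eq (tv c) (tv t₀))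
    (.imp γ (.box α Q φ))) ?_ (fun e => ht₁V (e ▸ hcV)) fun w hw₁ => ?_) hw₀
  · intro hd
    rw [Formula.imp, Formula.fv, Finset.mem_union] at hd
    refine hd.elim (fun hd => ?_) (hθ t₁ ht₁V)
    simp only [Formula.fv, Formula.eq, MvPolynomial.vars_X, Finset.mem_union,
      Finset.mem_singleton] at hd
    rcases hd with rfl | rfl
    · exact ht₁V hcV
    · exact ht₁ (Finset.mem_insert_self _ _)
  refine w.imp_iff.2 fun hw₀ => w.imp_iff.2 fun hw => ?_
  have hα₀ : t₀ ∉ α.fv ∪ Q.fv := fun h => ht₀ (Finset.union_subset hα hQ h)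
  -- The real induction axiom has no domain constraint, so `Q` moves into the hypothesis `B` about
  -- the past and the induction formula is `B → φ`.
  rw [box_iff_box_past hc hα₀ hw₀]
  set B := past α c t₀ Q with hB
  have hBV : B.fv ⊆ insert t₀ V := (fv_past_subset hc.mem Q).trans
    (Finset.insert_subset_insert _ (Finset.union_subset hα hQ))
  have hα₁ : t₁ ∉ α.fv ∪ (Formula.and Q B).fv := fun h => ht₁ (by
    rw [Formula.fv, ← Finset.union_assoc, Finset.mem_union] at h
    exact h.elim (fun h => Finset.mem_insert_of_mem (Finset.union_subset hα hQ h)) fun h => hBV h)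
  set V' := insert t₁ (insert t₀ V) with hV'
  have hVV' : V ⊆ V' := fun v hv => Finset.mem_insert_of_mem (Finset.mem_insert_of_mem hv)
  have hBV' : B.fv ⊆ V' := hBV.trans (Finset.subset_insert _ _)
  obtain ⟨σ, hσ⟩ := exists_isCopy α.vars V'
  have hΦ : (Formula.imp B φ).fv ⊆ V' := Finset.union_subset hBV' (hφ.trans hVV')
  refine box_of_realInduction hc hσ.fresh (hα.trans hVV') hΦ (γ := .and γ
    (.and (.eq (tv c) (tv t₀)) (.eq (tv c) (tv t₁)))) ?_ (fun w hw u hu hcopy => ?_)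
    (w.and_iff.2 ⟨hw, w.and_iff.2 ⟨hw₀, hw₁⟩⟩)
  · simp only [Formula.fv, Formula.eq, MvPolynomial.vars_X]
    have := hVV' hcV
    refine Finset.union_subset (hγ.trans hVV') ?_
    intro v hv
    simp only [Finset.mem_union, Finset.mem_singleton] at hv
    grind
  clear hw₀ hw₁
  simp only [w.and_iff] at hw
  obtain ⟨hw, hw₀, hw₁⟩ := hw
  have hbox : w (.box α Q B) := w.box_iff.2 fun v hv => ((Acc.iff_past hc hα₀ hw₀).1 hv).2
  by_cases huB : u B
  · have huQB := ((Acc.iff_past hc hα₀ hw₀).2 ⟨hu.to_tt, huB⟩).cut hbox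
    obtain ⟨huφ, hdia⟩ := h σ (hσ.mono hVV') w hw u ((Acc.and_iff.2 ⟨huQB, hu⟩).mono fun v hv => by
      simp only [v.and_iff, v.or_iff, v.imp_iff] at hv ⊢
      tauto) hcopy
    exact ⟨u.imp_iff.2 fun _ => huφ, u.dia_mono hdia (fun v hv => by
      simp only [v.or_iff, v.imp_iff] at hv ⊢
      tauto) fun v _ => id⟩
  · refine ⟨u.imp_iff.2 fun hB => absurd hB huB, ?_⟩
    -- Once `Q` has failed, `B → φ` should stay vacuously true. The nested `past` replaces an appeal
    -- to transitivity of accessibility: it holds whenever `B` does, and at a world `x` after `u` it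
    -- would give `B` back at `u`.
    have hboxX : w (.box α tt (.imp B (past α c t₁ (.and Q B)))) := w.box_iff.2 fun v hv =>
      v.imp_iff.2 fun hvB => ((Acc.iff_past hc hα₁ hw₁).1
        (((Acc.iff_past hc hα₀ hw₀).2 ⟨hv, hvB⟩).cut hbox)).2
    have hXV : (Formula.imp B (past α c t₁ (.and Q B))).fv ⊆ V' := by
      refine Finset.union_subset hBV' ((fv_past_subset hc.mem _).trans ?_)
      refine Finset.insert_subset (Finset.mem_insert_self _ _) ?_
      exact Finset.union_subset (hα.trans hVV') (Finset.union_subset (hQ.trans hVV') hBV')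
    obtain ⟨v, huv, hv⟩ := u.dia_iff.1
      (Acc.progress hc hσ.fresh (hα.trans hVV') hXV hboxX hu.to_tt hcopy)
    have huc : u (.ge (tv c) (tv t₁)) := hu.clock_ge hc
      (disjoint_vars_tv fun h => hα₁ (Finset.mem_union_left _ h))
      (w.fol₁ (fun ω => by simpa [Sat, Formula.eq, Formula.ge, Cmp.rel] using fun h => h.ge) hw₁)
    refine u.dia_iff.2 ⟨v, huv.of_reachable fun x hx => x.or_iff.2 ?_, hv⟩
    refine (x.or_iff.1 hx.domain).imp_left fun hX => x.imp_iff.2 fun hxB => absurd ?_ huB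
    exact (u.and_iff.1 (u.imp_iff.1 (hx.neg.to_tt _ (x.imp_iff.1 hX hxB)) huc)).2

end RealInduction

/-! ### Intermediate values -/

/-- If no zero of `e` is reached in the prescribed way, real induction along the given run yields `e
< 0` up to its end, where `e > 0`. -/
theorem World.dia_ivt (w : World) {α : ODE} {c : Var} {τ e : Term} {Q : Formula}
    (hc : α.IsClock c) (hτ : Disjoint τ.vars α.vars) (he : w (.le e 0))
    (h : w (.dia α Q (.and (.eq (tv c) τ) (.gt e 0)))) :
    w (.dia α (.and Q (.and (.lt (tv c) τ) (.le e 0))) (.eq e 0)) := by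
  by_contra hcon
  rw [World.dia_iff_not_box, not_not] at hcon
  obtain ⟨z, hz, hzc⟩ := w.dia_iff.1 h
  rw [z.and_iff] at hzc
  have hz' := hz.until_clock hc hτ hzc.1 hzc.2
  -- The last conjunct excludes `e ≤ 0` at time `τ`, which is what makes the bound `c < τ` strict.
  set Q' := Formula.and (.and Q (.le (tv c) τ)) (.imp (.eq (tv c) τ) (.gt e 0)) with hQ'
  set γ := Formula.and (.le e 0)
    (.box α (.and Q (.and (.lt (tv c) τ) (.le e 0))) (.not (.eq e 0))) with hγ
  have hboth : ∀ x : World, x (.lt e 0) → ¬ x (.gt e 0) := fun x h₁ h₂ =>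
    x.not_iff.1 (x.fol₁ (fun ω => by
      simpa [Sat, Formula.lt, Formula.gt, Cmp.rel] using le_of_lt) h₁) h₂
  have hbox : w (.box α Q' (.lt e 0)) := by
    refine box_of_realInduction_domain (γ := γ) (V := α.fv ∪ Q'.fv ∪ γ.fv) hc
      (fun v hv => by simp [hv]) (fun v hv => by simp [hv]) ?_ (fun v hv => by simp [hv]) ?_
      (w.and_iff.2 ⟨he, hcon⟩)
    · intro v hv
      have : v ∈ γ.fv := Finset.mem_union_left _ hv
      simp [this]
    clear! z w
    intro σ hσ w hw u hu hcopy
    have heV : e.vars ⊆ α.fv ∪ Q'.fv ∪ γ.fv := fun v hv => by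
      have : v ∈ γ.fv := Finset.mem_union_left _ (Finset.mem_union_left _ hv)
      simp [this]
    have hαV : α.fv ⊆ α.fv ∪ Q'.fv ∪ γ.fv := fun v hv => by simp [hv]
    have hcmp : ∀ r, (Formula.cmp r e 0).fv ⊆ α.fv ∪ Q'.fv ∪ γ.fv := fun r => by
      simpa [Formula.fv] using heV
    rw [hγ, w.and_iff] at hw
    obtain ⟨he, hbox⟩ := hw
    have hlt : u (.lt e 0) := by
      by_cases hgt : u (.gt e 0)
      · exfalso
        have hne : w (.not (atCopy σ α.vars)) := w.not_iff.2 fun hwc => by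
          have : w (.gt e 0) :=
            (hσ.rename_iff hwc).1 ((hσ.iff_rename rfl (hcmp _) hu hcopy).1 hgt)
          refine w.not_iff.1 (w.fol₁ (fun ω h => ?_) he) this
          simpa [Sat, Formula.gt, Formula.le, Cmp.rel] using h
        -- By continuity the reversed system leaves `u` with `e > 0`, while the way back to `w` has
        -- `e < 0` away from the copy. Uniqueness merges both into one world off the copy, where
        -- both signs would hold.
        have hback : u (.dia α.neg (.gt e 0) (.not (atCopy σ α.vars))) :=
          u.dia_of_pos (α := α.neg) hσ.fresh (by rwa [ODE.fv_neg]) heV hc.moves_neg hcopy hgt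
        obtain ⟨v, hv, hvne⟩ :=
          u.dia_iff.1 (u.dia_and hback (u.dia_iff.2 ⟨w, hu.neg, hne⟩))
        have hdom := hv.domain
        simp only [v.and_iff, v.or_iff] at hdom
        exact hdom.2.2.elim (fun h => hboth v h hdom.1) (v.not_iff.1 hvne)
      · by_cases heq : u (.eq e 0)
        · exfalso
          -- Up to `u` the run has `e ≤ 0`, hence also `c < τ`, so `u` would be one of the zeros
          -- excluded in `γ`.
          refine u.not_iff.1 (hu.of_reachable (fun v hv => ?_) _ hbox) heq
          have hdom := hv.domain
          simp only [hQ', v.and_iff, v.or_iff, v.imp_iff] at hdom ⊢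
          obtain ⟨⟨⟨hvQ, hvτ⟩, himp⟩, hor⟩ := hdom
          have hle : v (.le e 0) := by
            rcases hor with h | h
            · exact v.fol₁ (fun ω => by
                simpa [Sat, Formula.lt, Formula.le, Cmp.rel] using le_of_lt) h
            · exact v.fol₁ (fun ω => by
                simpa [Sat, Formula.eq, Formula.le, Cmp.rel] using le_of_eq)
                ((hσ.iff_rename rfl (hcmp .eq) hv h).2
                  ((hσ.iff_rename rfl (hcmp .eq) hu hcopy).1 heq))
          refine ⟨hvQ, ?_, hle⟩
          have hne : v (.not (.eq (tv c) τ)) := v.not_iff.2 fun h =>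
            v.not_iff.1 (v.fol₁ (fun ω h => by
              simpa [Sat, Formula.gt, Formula.le, Cmp.rel] using h) hle) (himp h)
          exact v.fol₂ (fun ω h₁ h₂ => by
            simp only [Sat, Formula.eq, Formula.le, Formula.lt, Cmp.rel] at h₁ h₂ ⊢
            exact lt_of_le_of_ne h₁ h₂) hvτ hne
        · refine u.fol₂ (φ := .not (.gt e 0)) (χ := .not (.eq e 0)) (fun ω h₁ h₂ => ?_)
            (u.not_iff.2 hgt) (u.not_iff.2 heq)
          simp only [Sat, Formula.eq, Formula.gt, Formula.lt, Cmp.rel, not_lt] at h₁ h₂ ⊢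
          exact lt_of_le_of_ne h₁ h₂
    refine ⟨hlt, ?_⟩
    have hpos : u (.gt (-e) 0) := u.fol₁ (fun ω => by
      simp [Sat, Formula.gt, Formula.lt, Cmp.rel, val]) hlt
    refine u.dia_mono (u.dia_of_pos hσ.fresh hαV (by rwa [MvPolynomial.vars_neg]) hc.moves hcopy
      hpos) (fun v hv => v.or_iff.2 (Or.inl ?_)) fun v _ => id
    exact v.fol₁ (fun ω => by simp [Sat, Formula.gt, Formula.lt, Cmp.rel, val]) hv
  exact hboth z (hz' _ hbox) hzc.2

theorem derivable_ivt (α : ODE) (t : Var) (τ e : Term) (Q : Formula) (ht : t ∉ α.vars)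
    (hτ : Disjoint τ.vars (α.withClock t).vars) :
    Derivable (.imp
      (.and (.le e 0) (.dia (α.withClock t) Q (.and (.eq (tv t) τ) (.gt e 0))))
      (.dia (α.withClock t) (.and Q (.and (.lt (tv t) τ) (.le e 0))) (.eq e 0))) := by
  refine derivable_of_worlds fun w => w.imp_iff.2 fun h => ?_
  rw [w.and_iff] at h
  exact w.dia_ivt (ODE.isClock_withClock ht) hτ h.1 h.2

/-! ### Comparison of two runs -/

/-- The intermediate value property for `c - d₁` stops the second run at time `d₁`, with its
remainder still ahead. Both runs then share the postcondition `c = d₁`, to which uniqueness applies.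
-/
theorem World.dia_and_dia_of_le (w : World) {α : ODE} {c d₁ d₂ : Var} {Q₁ Q₂ P₁ P₂ : Formula}
    (hc : α.IsClock c) (h₁ : d₁ ∉ α.fv) (h₂ : d₂ ∉ α.fv)
    (hw₁ : w (.dia α Q₁ (.and P₁ (.eq (tv c) (tv d₁)))))
    (hw₂ : w (.dia α Q₂ (.and P₂ (.eq (tv c) (tv d₂))))) (hle : w (.le (tv d₁) (tv d₂))) :
    w (.dia α (.and Q₁ Q₂) (.and P₁ (.dia α Q₂ P₂))) := by
  obtain ⟨u₁, hu₁, h⟩ := w.dia_iff.1 hw₁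
  obtain ⟨hP₁, hc₁⟩ := u₁.and_iff.1 h
  obtain ⟨u₂, hu₂, h⟩ := w.dia_iff.1 hw₂
  obtain ⟨hP₂, hc₂⟩ := u₂.and_iff.1 h
  have hd₁ := disjoint_vars_tv h₁
  have hd₂ := disjoint_vars_tv h₂
  have hrun₂ := hu₂.remaining fun v hv => v.dia_iff.2 ⟨u₂, hv, hP₂⟩
  have hle₂ : u₂ (.le (tv d₁) (tv d₂)) := by
    refine (hu₂.const ?_).1 hle
    simp only [Formula.le, Formula.fv, Finset.disjoint_union_left]
    exact ⟨hd₁, hd₂⟩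
  have hrun : w (.dia α (.and Q₂ (.dia α Q₂ P₂)) (.eq (tv c) (tv d₁))) := by
    -- `World.dia_ivt` needs `c - d₁` strictly positive at the end, so equal end times are treated
    -- separately.
    by_cases heq : u₂ (.eq (tv c) (tv d₁))
    · exact w.dia_iff.2 ⟨u₂, hrun₂, heq⟩
    · have hgt : u₂ (.gt (tv c - tv d₁) 0) := by
        refine u₂.fol₂ (φ := .and (.not (.eq (tv c) (tv d₁))) (.eq (tv c) (tv d₂)))
          (fun ω h h' => ?_) (u₂.and_iff.2 ⟨u₂.not_iff.2 heq, hc₂⟩) hle₂ ⟨trivial, trivial⟩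
        simp only [Sat, Formula.eq, Formula.le, Formula.gt, Cmp.rel] at h h' ⊢
        rw [← h.2] at h'
        simpa [val] using lt_of_le_of_ne h' (Ne.symm h.1)
      have hstart : w (.le (tv c - tv d₁) 0) :=
        w.fol₁ (fun ω => by simp [Sat, Formula.le, Cmp.rel, val])
          (hu₁.clock_le hc hd₁ (u₁.fol₁ (fun ω => by
            simpa [Sat, Formula.eq, Formula.le, Cmp.rel] using le_of_eq) hc₁))
      refine w.dia_mono (w.dia_ivt hc hd₂ hstart
        (w.dia_iff.2 ⟨u₂, hrun₂, u₂.and_iff.2 ⟨hc₂, hgt⟩⟩))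
        (fun v hv => (v.and_iff.1 hv).1) fun v _ hv => v.fol₁ (fun ω => ?_) hv
      simp [Sat, Formula.eq, Cmp.rel, val, sub_eq_zero]
  -- Uniqueness preserves only `c = d₁` as postcondition; `P₁` and the remaining second run are
  -- carried in the domain constraints.
  refine w.dia_mono (w.dia_and (w.dia_iff.2 ⟨u₁, hu₁.until_clock hc hd₁ hc₁ hP₁, hc₁⟩) hrun)
    (fun v hv => ?_) fun v hv hvc => ?_
  all_goals
    simp only [v.and_iff, v.imp_iff] at hv ⊢
    tauto

theorem ODE.fv_withClock (α : ODE) (c : Var) : (α.withClock c).fv ⊆ insert c α.fv := by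
  intro v hv
  simp only [ODE.fv, ODE.withClock, ODE.join, ODE.single, Finset.mem_union, Finset.mem_singleton,
    Finset.mem_biUnion, Finset.mem_insert] at hv ⊢
  rcases hv with (hv | hv) | ⟨u, hu, hv⟩
  · exact Or.inr (Or.inl hv)
  · exact Or.inl hv
  · have h1 : (Function.update (0 : Var → Term) c 1 u).vars = ∅ := by
      by_cases huc : u = c
      · simp [huc]
      · simp [huc]
    have hv := MvPolynomial.vars_add_subset _ _ hv
    rw [h1, Finset.union_empty] at hv
    refine Or.inr (Or.inr ⟨u, ?_, hv⟩)
    by_contra hun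
    simp [α.rhs_off u hun] at hv

/-- A fresh clock is the ghost `c' = 0 · c + 1`. -/
theorem World.box_withClock (w : World) {α : ODE} {Q φ : Formula} {c : Var}
    (hc : c ∉ α.fv ∪ Q.fv ∪ φ.fv) : w (.box α Q φ) ↔ w (.box (α.withClock c) Q φ) := by
  constructor
  · exact fun h => w.of_all (w.imp_iff.1 (w.of_ax (.ghostAll α Q φ c 1 hc)) h)
  · intro h
    have hax := w.iff_iff.1 (w.of_ax (.ghost α Q φ c 0 1 (by simpa using hc)))
    rw [zero_mul, zero_add] at hax
    exact hax.2 (w.ex_of h)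

theorem World.dia_withClock (w : World) {α : ODE} {Q φ : Formula} {c : Var}
    (hc : c ∉ α.fv ∪ Q.fv ∪ φ.fv) : w (.dia α Q φ) ↔ w (.dia (α.withClock c) Q φ) := by
  rw [w.dia_iff_not_box, w.dia_iff_not_box, w.box_withClock (φ := .not φ) hc]

theorem derivable_uniq (α : ODE) (P₁ P₂ Q₁ Q₂ : Formula) :
    Derivable (.imp (.and (.dia α Q₁ P₁) (.dia α Q₂ P₂))
      (.or (.dia α (.and Q₁ Q₂) (.and P₁ (.dia α Q₂ P₂)))
        (.dia α (.and Q₁ Q₂) (.and P₂ (.dia α Q₁ P₁))))) := by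
  set V := α.fv ∪ Q₁.fv ∪ Q₂.fv ∪ P₁.fv ∪ P₂.fv with hV
  obtain ⟨c, hcV⟩ := Infinite.exists_notMem_finset V
  obtain ⟨d₁, hd₁⟩ := Infinite.exists_notMem_finset (insert c V)
  obtain ⟨d₂, hd₂⟩ := Infinite.exists_notMem_finset (insert d₁ (insert c V))
  simp only [hV, Finset.mem_insert, Finset.mem_union, not_or] at hcV hd₁ hd₂
  have hc : (α.withClock c).IsClock c :=
    ODE.isClock_withClock fun h => hcV.1.1.1.1 (Finset.mem_union_left _ h)
  have hβ : ∀ d, d ≠ c → d ∉ α.fv → d ∉ (α.withClock c).fv := fun d hd hdα h =>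
    (Finset.mem_insert.1 (α.fv_withClock c h)).elim hd hdα
  have hβ₁ := hβ d₁ hd₁.1 hd₁.2.1.1.1.1
  have hβ₂ := hβ d₂ hd₂.2.1 hd₂.2.2.1.1.1.1
  have h₁ : ∀ w : World, w (.dia α Q₁ P₁) ↔ w (.dia (α.withClock c) Q₁ P₁) := fun w =>
    w.dia_withClock (by simp [hcV])
  have h₂ : ∀ w : World, w (.dia α Q₂ P₂) ↔ w (.dia (α.withClock c) Q₂ P₂) := fun w =>
    w.dia_withClock (by simp [hcV])
  set G := Formula.or (.dia α (.and Q₁ Q₂) (.and P₁ (.dia α Q₂ P₂)))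
    (.dia α (.and Q₁ Q₂) (.and P₂ (.dia α Q₁ P₁))) with hG
  have hGfv : ∀ d, d ∉ V → d ∉ G.fv := by
    intro d hd
    simp only [hV, hG, Formula.fv, Finset.mem_union] at hd ⊢
    tauto
  have main : ∀ w : World,
      w (.dia (α.withClock c) Q₁ (.and P₁ (.eq (tv c) (tv d₁)))) →
      w (.dia (α.withClock c) Q₂ (.and P₂ (.eq (tv c) (tv d₂)))) → w G := by
    intro w hw₁ hw₂
    rw [hG, w.or_iff, w.dia_withClock (c := c) (φ := .and P₁ _)
      (by simp [Formula.fv, hcV]), w.dia_withClock (c := c) (φ := .and P₂ _)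
      (by simp [Formula.fv, hcV])]
    by_cases hle : w (.le (tv d₁) (tv d₂))
    · refine Or.inl (w.dia_mono (w.dia_and_dia_of_le hc hβ₁ hβ₂ hw₁ hw₂ hle) (fun _ => id) ?_)
      exact fun v _ hv => v.and_iff.2 ((v.and_iff.1 hv).imp_right (h₂ v).2)
    · have hle : w (.le (tv d₂) (tv d₁)) :=
        w.fol₁ (φ := .not (.le (tv d₁) (tv d₂))) (fun ω => by
          simpa [Sat, Formula.le, Cmp.rel] using le_of_lt) (w.not_iff.2 hle)
      refine Or.inr (w.dia_mono (w.dia_and_dia_of_le hc hβ₂ hβ₁ hw₂ hw₁ hle) ?_ ?_)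
      · exact fun v hv => v.and_iff.2 (v.and_iff.1 hv).symm
      · exact fun v _ hv => v.and_iff.2 ((v.and_iff.1 hv).imp_right (h₁ v).2)
  refine derivable_of_worlds fun w => w.imp_iff.2 fun h => ?_
  rw [w.and_iff, h₁, h₂] at h
  obtain ⟨u₁, hu₁, hP₁⟩ := w.dia_iff.1 h.1
  -- Naming an end time changes the world, so the other diamond travels along as a hypothesis inside
  -- `θ`.
  refine w.imp_iff.1 (Acc.of_witness (θ := .imp (.dia (α.withClock c) Q₂ P₂) G) (v := c) (d := d₁)
    hβ₁ (by simp [hd₁]) (by simp [hd₁]) ?_ hd₁.1 (fun w u₁ hu₁ hP₁ hc₁ => ?_) hu₁ hP₁) h.2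
  · have := hGfv d₁ (by simp [hV, hd₁])
    simp [Formula.imp, Formula.fv, hβ₁, hd₁, this]
  refine w.imp_iff.2 fun h₂ => ?_
  obtain ⟨u₂, hu₂, hP₂⟩ := w.dia_iff.1 h₂
  refine w.imp_iff.1 (Acc.of_witness
    (θ := .imp (.dia (α.withClock c) Q₁ (.and P₁ (.eq (tv c) (tv d₁)))) G) (v := c) (d := d₂)
    hβ₂ (by simp [hd₂]) (by simp [hd₂]) ?_ hd₂.2.1 (fun w u₂ hu₂ hP₂ hc₂ => ?_) hu₂ hP₂)
    (w.dia_iff.2 ⟨u₁, hu₁, u₁.and_iff.2 ⟨hP₁, hc₁⟩⟩)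
  · have := hGfv d₂ (by simp [hV, hd₂])
    simp [Formula.imp, Formula.fv, Formula.eq, MvPolynomial.vars_X, hβ₂, hd₂, this]
  exact w.imp_iff.2 fun h => main w h (w.dia_iff.2 ⟨u₂, hu₂, u₂.and_iff.2 ⟨hP₂, hc₂⟩⟩)

end DL

theorem mainTheorem8 :
    -- Rev
    (∀ (α : DL.ODE) (P Q : DL.Formula),
      DL.Derivable (.imp P (.box α Q (.dia α.neg Q P)))) ∧
    -- Stuck
    (∀ (α : DL.ODE) (t : DL.Var) (t₀ : DL.Term) (P : DL.Formula),
      t ∉ α.vars → Disjoint t₀.vars (α.withClock t).vars →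
      DL.Derivable (.imp (.eq (DL.tv t) t₀)
        (.iff (.box (α.withClock t) (.le (DL.tv t) t₀) P) P))) ∧
    -- Idem
    (∀ (α : DL.ODE) (P Q : DL.Formula),
      DL.Derivable (.imp (.dia α Q P) (.dia α (.and Q (.dia α Q P)) P))) ∧
    -- Uniq'
    (∀ (α : DL.ODE) (P₁ P₂ Q₁ Q₂ : DL.Formula),
      DL.Derivable (.imp (.and (.dia α Q₁ P₁) (.dia α Q₂ P₂))
        (.or (.dia α (.and Q₁ Q₂) (.and P₁ (.dia α Q₂ P₂)))
          (.dia α (.and Q₁ Q₂) (.and P₂ (.dia α Q₁ P₁)))))) ∧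
    -- IVT
    (∀ (α : DL.ODE) (t : DL.Var) (τ e : DL.Term) (Q : DL.Formula),
      t ∉ α.vars → Disjoint τ.vars (α.withClock t).vars →
      DL.Derivable (.imp
        (.and (.le e 0) (.dia (α.withClock t) Q (.and (.eq (DL.tv t) τ) (.gt e 0))))
        (.dia (α.withClock t) (.and Q (.and (.lt (DL.tv t) τ) (.le e 0))) (.eq e 0)))) := by
  exact ⟨DL.derivable_rev, DL.derivable_stuck, DL.derivable_idem, DL.derivable_uniq,
    DL.derivable_ivt⟩
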